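/- Let $d,n\in\mathbb N$ and let $m$ be an integer with $m>d/2$. Let $\mathcal X\subset\mathbb R^d$ be a union of open balls of radius $r>0$ centred at the points of a bounded set. Let $\mathcal H$ be a reproducing kernel Hilbert space of real functions on $\mathcal X$ with kernel $k$, and let $M\ge 1$, $D_m\ge 1$ be such that - $u\cdot v\in\mathcal H$ and $\|u\cdot v\|_{\mathcal H}\le M\|u\|_{\mathcal H}\|v\|_{\mathcal H}$ for all $u,v\in\mathcal H$; - $k$ is $m$ times continuously differentiable in each argument (that is, $\partial_x^\alpha\partial_y^\beta k$ exists and is continuous on $\mathcal X\times\mathcal X$ for $|\alpha|,|\beta|\le m$), and $\max_{|\alpha|=m}\sup_{x,y\in\mathcal X}|\partial_x^\alpha\partial_y^\alpha k(x,y)|\le D_m^2$. Let $x_1,\dots,x_n\in\mathcal X$ have fill distance $$h=\sup_{x\in\mathcal X}\min_{1\le i\le n}\|x-x_i\|\le r\min\Bigl(1,\tfrac1{18(m-1)^2}\Bigr)$$ (where $\tfrac1{18(m-1)^2}=\infty$ if $m=1$). Let $R\in\mathbb R^{n\times n}$ be upper triangular with $R^TR=(k(x_i,x_j))_{i,j}$,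 and let $\Psi_j=R_{:,j}\otimes I_d\in\mathbb R^{nd\times d}$, where $R_{:,j}$ is the $j$-th column of $R$. Let $f\in C^{m+2}(\mathcal X)$, with Hessian $H_f$, and let $B\in\mathbb R^{nd\times nd}$ be symmetric positive semidefinite, such that $$H_f(x_j)=\Psi_j^TB\,\Psi_j,\qquad j=1,\dots,n.$$ Set $$C=C_0\Bigl(\sum_{i=1}^d|(H_f)_{ii}|_{\mathcal X,m}+M D_m\operatorname{tr}B\Bigr),\qquad C_0=3\,\frac{d^m}{m!}\max\bigl(1,18(m-1)^2\bigr)^m,$$ where $|g|_{\mathcal X,m}=\max_{|\alpha|=m}\sup_{x\in\mathcal X}|\partial^\alpha g(x)|\in[0,\infty]$. Then for every real $\eta\ge C\,h^m$, the function $x\mapsto f(x)+\tfrac\eta2\|x\|^2$ is convex on $\mathcal X$, that is, convex on every convex subset of $\mathcal X$ (equivalently, along every segment contained in $\mathcal X$; if $\mathcal X$ is convex, this is ordinary convexity on $\mathcal X$). -/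

import Mathlib

open scoped ENNReal Matrix

noncomputable section

namespace ScatteredConvexity

/-- `ℝ^d` with the Euclidean norm. -/
abbrev E (d : ℕ) : Type := EuclideanSpace ℝ (Fin d)

/-- The iterated partial derivative `∂_{σ 0} ⋯ ∂_{σ (j-1)} g (x)`. Running over all
`σ : Fin j → Fin d`, these are exactly the `∂^α g (x)` with `|α| = j`
(`α i` is the number of times that `σ` takes the value `i`). -/
def pderiv {d j : ℕ} (σ : Fin j → Fin d) (g : E d → ℝ) (x : E d) : ℝ :=
  iteratedFDeriv ℝ j g x (fun l => EuclideanSpace.single (σ l) (1 : ℝ))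

/-- The seminorm `|g|_{X,m} = max_{|α| = m} sup_{x ∈ X} |∂^α g (x)|`, with values in `[0, ∞]`. -/
def seminormCm {d : ℕ} (X : Set (E d)) (m : ℕ) (g : E d → ℝ) : ℝ≥0∞ :=
  ⨆ σ : Fin m → Fin d, ⨆ x ∈ X, ‖pderiv σ g x‖ₑ

/-- The Hessian matrix of `f` at `x`. -/
def hessian {d : ℕ} (f : E d → ℝ) (x : E d) : Matrix (Fin d) (Fin d) ℝ :=
  Matrix.of fun i j => pderiv ![i, j] f x

/-- `X` is the union of the open balls of radius `r > 0` centred at the points of a bounded set. -/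
def IsUnionOfBalls {d : ℕ} (X : Set (E d)) (r : ℝ) : Prop :=
  0 < r ∧ ∃ S : Set (E d), Bornology.IsBounded S ∧ X = ⋃ x ∈ S, Metric.ball x r

/-- The fill distance `sup_{x ∈ X} min_i ‖x - x_i‖`, with values in `[0, ∞]`. -/
def fillDistance {d n : ℕ} (xs : Fin n → E d) (X : Set (E d)) : ℝ≥0∞ :=
  ⨆ x ∈ X, ⨅ i, edist x (xs i)

/-- The Hilbert space `H` of real functions on `X` is closed under pointwise products, and
`‖u · v‖ ≤ M ‖u‖ ‖v‖`. -/
def ProductBounded {X : Type*} (H : Type*) [NormedAddCommGroup H] [InnerProductSpace ℝ H]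
    [RKHS ℝ H X ℝ] (M : ℝ) : Prop :=
  ∀ u v : H, ∃ w : H, (∀ x : X, w x = u x * v x) ∧ ‖w‖ ≤ M * ‖u‖ * ‖v‖

/-- The mixed derivative `∂_x^σ ∂_y^τ k (x, y)`. -/
def mixedDeriv {d i j : ℕ} (σ : Fin i → Fin d) (τ : Fin j → Fin d) (k : E d → E d → ℝ)
    (x y : E d) : ℝ :=
  pderiv σ (fun x' => pderiv τ (k x') y) x

/-- `k` is `m` times continuously differentiable on `X` in each of its two arguments: the mixed
derivatives of order at most `m` in `x` and at most `m` in `y` exist and are continuous on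
`X × X`. -/
structure KernelSmooth {d : ℕ} (k : E d → E d → ℝ) (X : Set (E d)) (m : ℕ) : Prop where
  contDiff_right : ∀ x ∈ X, ContDiffOn ℝ m (k x) X
  contDiff_left : ∀ j ≤ m, ∀ τ : Fin j → Fin d, ∀ y ∈ X,
    ContDiffOn ℝ m (fun x => pderiv τ (k x) y) X
  continuous_mixed : ∀ i ≤ m, ∀ j ≤ m, ∀ (σ : Fin i → Fin d) (τ : Fin j → Fin d),
    ContinuousOn (fun p : E d × E d => mixedDeriv σ τ k p.1 p.2) (X ×ˢ X)

/-- `k` is `m` times continuously differentiable in each argument and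
`max_{|α| = m} sup_{x, y ∈ X} |∂_x^α ∂_y^α k (x, y)| ≤ D ^ 2`. -/
def KernelDerivBounded {d : ℕ} (k : E d → E d → ℝ) (X : Set (E d)) (m : ℕ) (D : ℝ) : Prop :=
  KernelSmooth k X m ∧
    ∀ σ : Fin m → Fin d, ∀ x ∈ X, ∀ y ∈ X, |mixedDeriv σ σ k x y| ≤ D ^ 2

/-- `R` is an upper triangular factor of the kernel matrix: `Rᵀ R = (k (x_i, x_j))_{ij}`. -/
def IsUpperFactor {d n : ℕ} (R : Matrix (Fin n) (Fin n) ℝ) (k : E d → E d → ℝ)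
    (xs : Fin n → E d) : Prop :=
  (∀ i j, j < i → R i j = 0) ∧ Rᵀ * R = Matrix.of fun i j => k (xs i) (xs j)

/-- The `nd × d` matrix `Ψ_l = R_{:, l} ⊗ I_d`. -/
def Psi {n : ℕ} (d : ℕ) (R : Matrix (Fin n) (Fin n) ℝ) (l : Fin n) :
    Matrix (Fin n × Fin d) (Fin d) ℝ :=
  Matrix.of fun p b => R p.1 l * (1 : Matrix (Fin d) (Fin d) ℝ) p.2 b

/-- `C₀ = 3 (d ^ m / m!) max(1, 18 (m - 1)²) ^ m`. -/
def constC0 (d m : ℕ) : ℝ :=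
  3 * ((d : ℝ) ^ m / (m.factorial : ℝ)) * (max 1 (18 * ((m : ℝ) - 1) ^ 2)) ^ m

/-- `C = C₀ (∑_i |(H_f)_ii|_{X,m} + M D tr B)`, with values in `[0, ∞]`. -/
def constC {d n : ℕ} (X : Set (E d)) (m : ℕ) (f : E d → ℝ) (M D : ℝ)
    (B : Matrix (Fin n × Fin d) (Fin n × Fin d) ℝ) : ℝ≥0∞ :=
  ENNReal.ofReal (constC0 d m) *
    (∑ i, seminormCm X m (fun x => hessian f x i i) + ENNReal.ofReal (M * D * B.trace))

/-- `g` is convex on the open, possibly non-convex, set `X`: it is convex on every convex subset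
of `X`, i.e. along every segment contained in `X`. -/
def IsConvexOn {d : ℕ} (g : E d → ℝ) (X : Set (E d)) : Prop :=
  ∀ S ⊆ X, Convex ℝ S → ConvexOn ℝ S g

end ScatteredConvexity

end

noncomputable section

namespace ScatteredConvexity

/-! Convexity of `f + η/2 ‖x‖²` along segments in `X` amounts to `vᵀ H_f(x) v ≥ -η` for every `x ∈
X` and unit vector `v`. Fix `v`. The matrix identity at the nodes extends to a nonnegative function:
with `B = AᵀA`, the form `vᵀ Ψᵀ B Ψ v` is a sum of squares of elements of `H` evaluated at the
nodes, so there is `b ≥ 0` on `X` agreeing with `vᵀ H_f v` at every `x_j` (`exists_model`). It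
remains to bound `defect = vᵀ H_f v - b`, which vanishes at the nodes, by `C h^m` (`abs_defect_le`).

Derivatives of `b`: the product bound places each square in `H`, and the total norm is at most `M tr
B`. Order-`m` derivatives of an element `u` are at most `D ‖u‖` (`abs_dlist_le_of_mem`); this comes
from pairing `u` with iterated differences of kernel sections, whose norms are controlled by the
mixed derivatives of `k`.

Vanishing at scattered points: on a ball of radius `ρ = 17 (m-1)² h` inside `X`, a polynomial of
moderate degree is controlled by its values at `h`-dense points (`norming`, from Markov's inequality
at an endpoint). Thus a function that is zero at the nodes and within `ε` of such a polynomial is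
`O(ε)` on the whole ball.

The delicate point is the polynomial approximation, since only the diagonal entries `∂_c² f` are
bounded in the order-`m` seminorm. A derivative of `f` of order `m + 2` is controlled once some
index occurs twice. If `d ≤ m + 1`, the pigeonhole principle forces a repetition and Taylor
polynomials suffice (`exists_approx_of_le`). If `m + 2 ≤ d < 2m`, consider `∂_a ∂_b f` with `a ≠ b`
and subtract its Taylor polynomial of degree less than `m`. The remainder has small first
derivatives in directions `a` and `b`, and small pure second derivatives in the other directions.
Hence it is nearly independent of `x_a, x_b` and nearly multilinear in the remaining `d - 2`
coordinates. Multilinear interpolation at the vertices of an inscribed cube makes this quantitative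
(`exists_approx_of_ge`), and degree `d - 2 ≤ 2m - 3` is still low enough for norming. -/

/-! ### Iterated partial derivatives indexed by lists. -/

/-- The partial derivative of `g` in the `i`-th coordinate direction. -/
def dpart {d : ℕ} (i : Fin d) (g : E d → ℝ) (x : E d) : ℝ :=
  fderiv ℝ g x (EuclideanSpace.single i 1)

/-- Iterated partial derivatives; the head of the list is differentiated first. -/
def dlist {d : ℕ} : List (Fin d) → (E d → ℝ) → E d → ℝ
  | [], g => g
  | i :: l, g => dlist l (dpart i g)

variable {d : ℕ}

@[simp] lemma dlist_nil (g : E d → ℝ) : dlist [] g = g := rfl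

@[simp] lemma dlist_cons (i : Fin d) (l : List (Fin d)) (g : E d → ℝ) :
    dlist (i :: l) g = dlist l (dpart i g) := rfl

lemma dlist_append (l l' : List (Fin d)) (g : E d → ℝ) :
    dlist (l ++ l') g = dlist l' (dlist l g) := by
  induction l generalizing g with
  | nil => rfl
  | cons i l ih => simp [ih]

lemma dpart_contDiffOn {X : Set (E d)} (hX : IsOpen X) {n : ℕ} {g : E d → ℝ}
    (hg : ContDiffOn ℝ (n + 1 : ℕ) g X) (i : Fin d) : ContDiffOn ℝ n (dpart i g) X := by
  have h := hg.fderiv_of_isOpen hX (m := n) (by norm_cast)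
  exact h.clm_apply contDiffOn_const

lemma dlist_contDiffOn {X : Set (E d)} (hX : IsOpen X) (l : List (Fin d)) {n : ℕ} {g : E d → ℝ}
    (hg : ContDiffOn ℝ (n + l.length : ℕ) g X) : ContDiffOn ℝ n (dlist l g) X := by
  induction l generalizing g with
  | nil => simpa using hg
  | cons i l ih => exact ih (dpart_contDiffOn hX (by simpa [add_assoc] using hg) i)

lemma dpart_congr {X : Set (E d)} (hX : IsOpen X) {g g' : E d → ℝ} (h : Set.EqOn g g' X)
    (i : Fin d) : Set.EqOn (dpart i g) (dpart i g') X := fun x hx => by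
  have : g =ᶠ[nhds x] g' := h.eventuallyEq_of_mem (hX.mem_nhds hx)
  simp only [dpart, this.fderiv_eq]

lemma dlist_congr {X : Set (E d)} (hX : IsOpen X) (l : List (Fin d)) {g g' : E d → ℝ}
    (h : Set.EqOn g g' X) : Set.EqOn (dlist l g) (dlist l g') X := by
  induction l generalizing g g' with
  | nil => exact h
  | cons i l ih => exact ih (dpart_congr hX h i)

lemma differentiableAt_of_contDiffOn {X : Set (E d)} (hX : IsOpen X) {n : ℕ} (hn : n ≠ 0)
    {g : E d → ℝ} (hg : ContDiffOn ℝ n g X) {x : E d} (hx : x ∈ X) : DifferentiableAt ℝ g x :=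
  (hg.contDiffAt (hX.mem_nhds hx)).differentiableAt (by exact_mod_cast hn)

lemma dpart_comm {X : Set (E d)} (hX : IsOpen X) {g : E d → ℝ} (hg : ContDiffOn ℝ 2 g X)
    (i j : Fin d) : Set.EqOn (dpart i (dpart j g)) (dpart j (dpart i g)) X := fun x hx => by
  have hc : ContDiffAt ℝ 2 g x := hg.contDiffAt (hX.mem_nhds hx)
  have hs : IsSymmSndFDerivAt ℝ g x := hc.isSymmSndFDerivAt (by simp)
  have hd : DifferentiableAt ℝ (fderiv ℝ g) x :=
    (hc.fderiv_right (m := 1) (by norm_num)).differentiableAt (by norm_num)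
  have key (a b : E d) : fderiv ℝ (fun y => fderiv ℝ g y a) x b = fderiv ℝ (fderiv ℝ g) x b a := by
    rw [fderiv_clm_apply hd (differentiableAt_const a)]; simp
  change fderiv ℝ (fun y => fderiv ℝ g y _) x _ = fderiv ℝ (fun y => fderiv ℝ g y _) x _
  rw [key, key]
  exact hs _ _

/-- Adjacent swaps come from symmetry of the second derivative, and they generate all permutations.
This allows a repeated index to be moved to the front, where a bound on `∂_c² f` applies. -/
lemma dlist_perm {X : Set (E d)} (hX : IsOpen X) {l l' : List (Fin d)} (hl : l.Perm l')
    {g : E d → ℝ} (hg : ContDiffOn ℝ (l.length : ℕ) g X) :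
    Set.EqOn (dlist l g) (dlist l' g) X := by
  induction hl generalizing g with
  | nil => exact fun x _ => rfl
  | cons i _ ih => exact ih (dpart_contDiffOn hX hg i)
  | swap i j l =>
    exact dlist_congr hX l (dpart_comm hX (hg.of_le (by simp; norm_cast; omega)) i j)
  | trans h1 _ ih1 ih2 =>
    exact (ih1 hg).trans (ih2 (by rwa [← h1.length_eq]))

lemma pderiv_succ {X : Set (E d)} (hX : IsOpen X) {j : ℕ} {g : E d → ℝ}
    (hg : ContDiffOn ℝ (j + 1 : ℕ) g X) (σ : Fin (j + 1) → Fin d) {x : E d} (hx : x ∈ X) :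
    pderiv σ g x = pderiv (Fin.init σ) (dpart (σ (Fin.last j)) g) x := by
  have hc : ContDiffAt ℝ j (fderiv ℝ g) x :=
    (hg.contDiffAt (hX.mem_nhds hx)).fderiv_right (by norm_cast)
  have h := ContinuousLinearMap.iteratedFDeriv_comp_left
    (ContinuousLinearMap.apply ℝ ℝ (EuclideanSpace.single (σ (Fin.last j)) (1 : ℝ) : E d)) hc
    (i := j) le_rfl
  simp only [pderiv]
  rw [iteratedFDeriv_succ_apply_right]
  have h2 := congrArg (fun A => A (fun l => EuclideanSpace.single (Fin.init σ l) (1 : ℝ))) h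
  simp only [ContinuousLinearMap.compContinuousMultilinearMap_coe, Function.comp_apply,
    ContinuousLinearMap.apply_apply] at h2
  exact h2.symm

/-- The last argument of `iteratedFDeriv` is the innermost derivative, whereas `dlist`
differentiates along the head first; hence the reversal. -/
lemma pderiv_eq_dlist {X : Set (E d)} (hX : IsOpen X) {j : ℕ} {g : E d → ℝ}
    (hg : ContDiffOn ℝ j g X) (σ : Fin j → Fin d) {x : E d} (hx : x ∈ X) :
    pderiv σ g x = dlist (List.ofFn σ).reverse g x := by
  induction j generalizing g with
  | zero => simp [pderiv]
  | succ j ih =>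
    rw [pderiv_succ hX hg σ hx, ih (dpart_contDiffOn hX hg _), List.ofFn_succ', List.concat_eq_append,
      List.reverse_append]
    rfl

lemma exists_reverse_ofFn_eq {α : Type*} {m : ℕ} (l : List α) (hl : l.length = m) :
    ∃ σ : Fin m → α, (List.ofFn σ).reverse = l := by
  have (l' : List α) (hl' : l'.length = m) : ∃ σ : Fin m → α, List.ofFn σ = l' := by
    subst hl'
    exact ⟨l'.get, List.ofFn_get l'⟩
  obtain ⟨σ, h⟩ := this l.reverse (by simpa using hl)
  exact ⟨σ, by rw [h, List.reverse_reverse]⟩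

/-! ### Taylor polynomials and their remainders. -/

/-- The value at `w` of the `j`-th derivative of `g` at `c`, as a homogeneous polynomial. -/
def hom : ℕ → (E d → ℝ) → E d → E d → ℝ
  | 0, g, c, _ => g c
  | j + 1, g, c, w => ∑ i, w i * hom j (dpart i g) c w

/-- The Taylor polynomial of `g` at `c`, of degree less than `n`. -/
def taylorPoly (n : ℕ) (g : E d → ℝ) (c x : E d) : ℝ :=
  ∑ j ∈ Finset.range n, hom j g c (x - c) / j.factorial

lemma hom_congr {X : Set (E d)} (hX : IsOpen X) {j : ℕ} {g g' : E d → ℝ}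
    (h : Set.EqOn g g' X) {c : E d} (hc : c ∈ X) (w : E d) : hom j g c w = hom j g' c w := by
  induction j generalizing g g' with
  | zero => exact h hc
  | succ j ih => exact Finset.sum_congr rfl fun i _ => by rw [ih (dpart_congr hX h i)]

lemma fderiv_eq_sum_dpart (g : E d → ℝ) (x w : E d) :
    fderiv ℝ g x w = ∑ i, w i * dpart i g x := by
  conv_lhs => rw [← (EuclideanSpace.basisFun (Fin d) ℝ).sum_repr w]
  simp [dpart]

lemma hom_line_hasDerivAt {X : Set (E d)} (hX : IsOpen X) {j : ℕ} {g : E d → ℝ}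
    (hg : ContDiffOn ℝ (j + 1 : ℕ) g X) (c w : E d) {t : ℝ} (ht : c + t • w ∈ X) :
    HasDerivAt (fun s : ℝ => hom j g (c + s • w) w) (hom (j + 1) g (c + t • w) w) t := by
  induction j generalizing g with
  | zero =>
    have h1 : HasDerivAt (fun s : ℝ => c + s • w) w t := by
      simpa using ((hasDerivAt_id t).smul_const w).const_add c
    have h2 := (differentiableAt_of_contDiffOn hX (by simp) hg ht).hasFDerivAt
    have h3 := h2.comp_hasDerivAt t h1
    rw [fderiv_eq_sum_dpart] at h3
    exact h3
  | succ j ih =>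
    have := HasDerivAt.fun_sum (u := Finset.univ)
      (fun i _ => (ih (dpart_contDiffOn hX hg i)).const_mul (w i))
    exact this

lemma abs_hom_le {j : ℕ} {g : E d → ℝ} {c : E d} {K : ℝ}
    (hK : ∀ l : List (Fin d), l.length = j → |dlist l g c| ≤ K) (w : E d) :
    |hom j g c w| ≤ (∑ i, |w i|) ^ j * K := by
  induction j generalizing g with
  | zero => simpa [hom] using hK [] rfl
  | succ j ih =>
    calc |hom (j + 1) g c w| ≤ ∑ i, |w i * hom j (dpart i g) c w| := Finset.abs_sum_le_sum_abs _ _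
      _ ≤ ∑ i, |w i| * ((∑ i, |w i|) ^ j * K) := by
          refine Finset.sum_le_sum fun i _ => ?_
          rw [abs_mul]
          exact mul_le_mul_of_nonneg_left
            (ih fun l hl => hK (i :: l) (by simp [hl])) (abs_nonneg _)
      _ = _ := by rw [← Finset.sum_mul]; ring

/-- Taylor's formula for a chain in which `φ (j + 1)` is the derivative of `φ j`. The derivative of
the remainder is the remainder of the shifted chain, so the bound is integrated once per induction
step. -/
lemma taylor_aux {n : ℕ} {φ : ℕ → ℝ → ℝ} {B : ℝ}
    (hφ : ∀ j < n, ∀ t ∈ Set.Icc (0 : ℝ) 1, HasDerivAt (φ j) (φ (j + 1) t) t)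
    (hB : ∀ t ∈ Set.Icc (0 : ℝ) 1, |φ n t| ≤ B) {t : ℝ} (ht : t ∈ Set.Icc (0 : ℝ) 1) :
    |φ 0 t - ∑ j ∈ Finset.range n, φ j 0 * t ^ j / j.factorial| ≤ B * t ^ n / n.factorial := by
  induction n generalizing φ t with
  | zero => simpa using hB t ht
  | succ n ih =>
    have ih' := fun t ht => ih (φ := fun j => φ (j + 1)) (t := t)
      (fun j hj t ht => hφ (j + 1) (by omega) t ht) hB ht
    have hd : ∀ x ∈ Set.Icc (0 : ℝ) 1, HasDerivAt
        (fun t => φ 0 t - ∑ j ∈ Finset.range (n + 1), φ j 0 * t ^ j / j.factorial)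
        (φ 1 x - ∑ j ∈ Finset.range n, φ (j + 1) 0 * x ^ j / j.factorial) x := by
      intro x hx
      refine (hφ 0 (by omega) x hx).sub ?_
      simp_rw [Finset.sum_range_succ' (fun j => φ j 0 * _ ^ j / (j.factorial : ℝ)) n]
      simp only [pow_zero, Nat.factorial_zero]
      refine HasDerivAt.add_const _ (HasDerivAt.fun_sum fun j _ => ?_)
      have := (((hasDerivAt_pow (j + 1) x).const_mul (φ (j + 1) 0)).div_const
        ((j + 1).factorial : ℝ))
      refine this.congr_deriv ?_
      rw [Nat.factorial_succ]
      push_cast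
      have : (j.factorial : ℝ) ≠ 0 := by positivity
      field_simp
    have hBd : ∀ x, HasDerivAt (fun t : ℝ => B * t ^ (n + 1) / (n + 1).factorial)
        (B * x ^ n / n.factorial) x := by
      intro x
      have := (((hasDerivAt_pow (n + 1) x).const_mul B).div_const ((n + 1).factorial : ℝ))
      refine this.congr_deriv ?_
      rw [Nat.factorial_succ]
      push_cast
      have : (n.factorial : ℝ) ≠ 0 := by positivity
      field_simp
    have := image_norm_le_of_norm_deriv_right_le_deriv_boundary (a := 0) (b := 1)
      (f := fun t => φ 0 t - ∑ j ∈ Finset.range (n + 1), φ j 0 * t ^ j / j.factorial)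
      (f' := fun x => φ 1 x - ∑ j ∈ Finset.range n, φ (j + 1) 0 * x ^ j / j.factorial)
      (B := fun t : ℝ => B * t ^ (n + 1) / (n + 1).factorial)
      (B' := fun x => B * x ^ n / n.factorial)
      (fun x hx => (hd x hx).continuousAt.continuousWithinAt)
      (fun x hx => (hd x ⟨hx.1, hx.2.le⟩).hasDerivWithinAt)
      (by simp [Finset.sum_range_succ'])
      hBd
      (fun x hx => ih' x ⟨hx.1, hx.2.le⟩)
    exact this ht

lemma sum_abs_le_sqrt_mul_norm (w : E d) : ∑ i, |w i| ≤ √d * ‖w‖ := by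
  have h := Finset.sum_mul_sq_le_sq_mul_sq Finset.univ (fun _ : Fin d => (1 : ℝ)) (fun i => |w i|)
  simp only [one_mul, one_pow, Finset.sum_const, Finset.card_univ, Fintype.card_fin, nsmul_eq_mul,
    mul_one, sq_abs] at h
  rw [EuclideanSpace.norm_eq, ← Real.sqrt_mul (by positivity)]
  refine Real.le_sqrt_of_sq_le ?_
  simpa using h

/-- Restricting to the segment reduces to one variable. The directional derivative of order `m`
costs the `ℓ¹` norm of `x - c` to the power `m`, and `ℓ¹ ≤ √d ℓ²` produces the factor `√d ^ m`. -/
lemma abs_sub_taylorPoly_le_of_segment {X : Set (E d)} (hX : IsOpen X) {m : ℕ} {g : E d → ℝ}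
    (hg : ContDiffOn ℝ m g X) {c x : E d} {ρ K : ℝ}
    (hseg : ∀ t ∈ Set.Icc (0 : ℝ) 1, c + t • (x - c) ∈ X) (hK0 : 0 ≤ K)
    (hK : ∀ l : List (Fin d), l.length = m → ∀ t ∈ Set.Icc (0 : ℝ) 1,
      |dlist l g (c + t • (x - c))| ≤ K) (hx : ‖x - c‖ ≤ ρ) :
    |g x - taylorPoly m g c x| ≤ K * (√d * ρ) ^ m / m.factorial := by
  have h1 : (∑ i, |(x - c) i|) ≤ √d * ρ :=
    (sum_abs_le_sqrt_mul_norm _).trans (mul_le_mul_of_nonneg_left hx (Real.sqrt_nonneg _))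
  have h := taylor_aux (n := m) (φ := fun j t => hom j g (c + t • (x - c)) (x - c))
    (B := K * (√d * ρ) ^ m)
    (fun j hj t ht => hom_line_hasDerivAt hX
      (hg.of_le (by exact_mod_cast hj)) c (x - c) (hseg t ht))
    (fun t ht => (abs_hom_le (fun l hl => hK l hl t ht) _).trans (by
      rw [mul_comm]
      gcongr)) (t := 1) (by simp)
  simpa [hom, taylorPoly] using h

lemma segment_mem_closedBall {c x : E d} {ρ : ℝ} (hx : x ∈ Metric.closedBall c ρ) {t : ℝ}
    (ht : t ∈ Set.Icc (0 : ℝ) 1) : c + t • (x - c) ∈ Metric.closedBall c ρ := by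
  rw [mem_closedBall_iff_norm] at hx ⊢
  rw [add_sub_cancel_left, norm_smul, Real.norm_of_nonneg ht.1]
  nlinarith [norm_nonneg (x - c), ht.2]

lemma abs_sub_taylorPoly_le {X : Set (E d)} (hX : IsOpen X) {m : ℕ} {g : E d → ℝ}
    (hg : ContDiffOn ℝ m g X) {c : E d} {ρ K : ℝ} (hball : Metric.closedBall c ρ ⊆ X)
    (hK0 : 0 ≤ K)
    (hK : ∀ l : List (Fin d), l.length = m → ∀ x ∈ Metric.closedBall c ρ, |dlist l g x| ≤ K)
    {x : E d} (hx : x ∈ Metric.closedBall c ρ) :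
    |g x - taylorPoly m g c x| ≤ K * (√d * ρ) ^ m / m.factorial :=
  abs_sub_taylorPoly_le_of_segment hX hg
    (fun _ ht => hball (segment_mem_closedBall hx ht)) hK0
    (fun l hl _ ht => hK l hl _ (segment_mem_closedBall hx ht)) (mem_closedBall_iff_norm.1 hx)

/-- The product rule yields one term from the factor `w i` and `j` from the inductive hypothesis;
symmetry of derivatives identifies them. The truncated `j - 1` is harmless at `j = 0` because of the
factor `j`. -/
lemma hom_hasFDerivAt_aux {X : Set (E d)} (hX : IsOpen X) {j : ℕ} {c : E d} (hc : c ∈ X) :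
    (∀ (g : E d → ℝ), Differentiable ℝ (hom j g c)) ∧
    ∀ (g : E d → ℝ), ContDiffOn ℝ j g X → ∀ (i : Fin d) (w : E d),
      dpart i (hom j g c) w = j * hom (j - 1) (dpart i g) c w := by
  induction j with
  | zero =>
    refine ⟨fun g => differentiable_const (g c), fun g _ i w => ?_⟩
    simp [dpart, hom]
  | succ j ih =>
    have hp (i : Fin d) (w : E d) : HasFDerivAt (fun w : E d => w i)
        (EuclideanSpace.proj i : E d →L[ℝ] ℝ) w := (EuclideanSpace.proj i : E d →L[ℝ] ℝ).hasFDerivAt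
    have hd (g : E d → ℝ) (w : E d) := HasFDerivAt.fun_sum (u := Finset.univ)
      (fun i _ => (hp i w).mul (ih.1 (dpart i g) w).hasFDerivAt)
    refine ⟨fun g w => (hd g w).differentiableAt, fun g hg k w => ?_⟩
    have h1 : dpart k (hom (j + 1) g c) w = _ := congrArg (fun A => A (EuclideanSpace.single k 1))
      (hd g w).fderiv
    rw [h1]
    have h2 (i : Fin d) : fderiv ℝ (hom j (dpart i g) c) w (EuclideanSpace.single k 1)
        = j * hom (j - 1) (dpart i (dpart k g)) c w := by
      refine (ih.2 (dpart i g) (dpart_contDiffOn hX hg i) k w).trans ?_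
      rcases j with _ | j
      · simp
      · rw [hom_congr hX (dpart_comm hX (hg.of_le (by norm_cast; omega)) k i) hc]
    simp only [FunLike.coe_sum, Finset.sum_apply, FunLike.coe_add, Pi.add_apply,
      FunLike.coe_smul, Pi.smul_apply, h2, smul_eq_mul, PiLp.proj_apply,
      PiLp.single_apply]
    rw [Finset.sum_add_distrib]
    simp only [mul_ite, mul_one, mul_zero, Finset.sum_ite_eq', Finset.mem_univ, if_true]
    rcases j with _ | j
    · simp
    · simp only [Nat.add_sub_cancel]
      rw [show hom (j + 1) (dpart k g) c w = ∑ i, w i * hom j (dpart i (dpart k g)) c w from rfl]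
      rw [Finset.mul_sum, ← Finset.sum_add_distrib]
      refine Finset.sum_congr rfl fun i _ => ?_
      push_cast
      ring

lemma taylorPoly_differentiable {X : Set (E d)} (hX : IsOpen X) (n : ℕ) (g : E d → ℝ) {c : E d}
    (hc : c ∈ X) : Differentiable ℝ (taylorPoly n g c) := by
  unfold taylorPoly
  refine Differentiable.fun_sum fun j _ => ?_
  have h := ((hom_hasFDerivAt_aux hX (j := j) hc).1 g).comp (differentiable_id.sub_const c)
  simpa [div_eq_inv_mul, Function.comp_def] using h.const_mul ((j.factorial : ℝ)⁻¹)

/-- Differentiation commutes with Taylor expansion up to a shift of the degree, so derivatives of a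
remainder are again remainders. -/
lemma dpart_taylorPoly {X : Set (E d)} (hX : IsOpen X) {n : ℕ} {g : E d → ℝ}
    (hg : ContDiffOn ℝ n g X) {c : E d} (hc : c ∈ X) (i : Fin d) :
    dpart i (taylorPoly (n + 1) g c) = taylorPoly n (dpart i g) c := by
  funext x
  have hj (j : ℕ) : HasFDerivAt (fun x => hom j g c (x - c) / j.factorial)
      (((j.factorial : ℝ)⁻¹) • fderiv ℝ (hom j g c) (x - c)) x := by
    have := ((hom_hasFDerivAt_aux hX (j := j) hc).1 g (x - c)).hasFDerivAt.comp x
      ((hasFDerivAt_id x).sub_const c)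
    simpa [div_eq_inv_mul] using this.const_mul ((j.factorial : ℝ)⁻¹)
  have h := (HasFDerivAt.fun_sum (u := Finset.range (n + 1)) fun j _ => hj j).fderiv
  have h1 : dpart i (taylorPoly (n + 1) g c) x = _ :=
    congrArg (fun A => A (EuclideanSpace.single i 1)) h
  rw [h1]
  simp only [FunLike.coe_sum, Finset.sum_apply, FunLike.coe_smul, Pi.smul_apply, smul_eq_mul]
  rw [Finset.sum_range_succ']
  simp only [taylorPoly]
  have h0 : fderiv ℝ (hom 0 g c) (x - c) (EuclideanSpace.single i 1) = 0 := by
    simp [show hom 0 g c = fun _ => g c from rfl]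
  rw [h0, mul_zero, add_zero]
  refine Finset.sum_congr rfl fun j hj => ?_
  have := (hom_hasFDerivAt_aux hX (j := j + 1) hc).2 g
    (hg.of_le (by norm_cast; simp at hj; omega)) i (x - c)
  rw [show fderiv ℝ (hom (j + 1) g c) (x - c) (EuclideanSpace.single i 1)
    = dpart i (hom (j + 1) g c) (x - c) from rfl, this, Nat.factorial_succ]
  push_cast
  have : (j.factorial : ℝ) ≠ 0 := by positivity
  field_simp

/-! ### Markov's inequality and norming sets for polynomials on a ball. -/

/-- The Chebyshev polynomial `T_N` is extremal at the endpoint, and `T_N'(1) = N²`. Applying this to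
`q / A` and `-q / A` gives both signs. -/
lemma abs_eval_derivative_one_le {N : ℕ} {q : Polynomial ℝ} (hq : q.natDegree ≤ N) {A : ℝ}
    (hA : 0 < A) (hb : ∀ x ∈ Set.Icc (-1 : ℝ) 1, |q.eval x| ≤ A) :
    |q.derivative.eval 1| ≤ N ^ 2 * A := by
  have hT : (Polynomial.derivative (Polynomial.Chebyshev.T ℝ N)).eval 1 = (N : ℝ) ^ 2 := by
    rw [Polynomial.Chebyshev.T_derivative_eq_U]
    simp [Polynomial.Chebyshev.U_eval_one]
    ring
  have key (p : Polynomial ℝ) (hp : p.natDegree ≤ N)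
      (hpb : ∀ x ∈ Set.Icc (-1 : ℝ) 1, |p.eval x| ≤ 1) : p.derivative.eval 1 ≤ (N : ℝ) ^ 2 := by
    have := Polynomial.Chebyshev.eval_iterate_derivative_le_of_forall_abs_le_one (n := N) (k := 1)
      (x := 1) le_rfl (Polynomial.degree_le_of_natDegree_le hp) hpb
    simpa [hT] using this
  have h1 := key (Polynomial.C A⁻¹ * q) ((Polynomial.natDegree_C_mul_le _ _).trans hq) (by
    intro x hx
    rw [Polynomial.eval_mul, Polynomial.eval_C, abs_mul, abs_of_pos (inv_pos.2 hA)]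
    rw [inv_mul_le_iff₀ hA]; simpa using hb x hx)
  have h2 := key (Polynomial.C (-A⁻¹) * q) ((Polynomial.natDegree_C_mul_le _ _).trans hq) (by
    intro x hx
    rw [Polynomial.eval_mul, Polynomial.eval_C, abs_mul, abs_neg, abs_of_pos (inv_pos.2 hA)]
    rw [inv_mul_le_iff₀ hA]; simpa using hb x hx)
  simp only [Polynomial.derivative_C_mul, Polynomial.eval_mul, Polynomial.eval_C] at h1 h2
  have h1' : q.derivative.eval 1 ≤ N ^ 2 * A := by
    rw [inv_mul_le_iff₀ hA] at h1; linarith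
  have h2' : -q.derivative.eval 1 ≤ N ^ 2 * A := by
    have : A⁻¹ * (-q.derivative.eval 1) ≤ N ^ 2 := by linarith
    rw [inv_mul_le_iff₀ hA] at this; linarith
  exact abs_le.2 ⟨by linarith, h1'⟩

/-- Markov's inequality at an endpoint of an interval. -/
lemma abs_eval_derivative_le {N : ℕ} {q : Polynomial ℝ} (hq : q.natDegree ≤ N) {A : ℝ}
    (hA : 0 < A) {e t : ℝ} (het : e ≠ t) (hb : ∀ x ∈ Set.uIcc e t, |q.eval x| ≤ A) :
    |q.derivative.eval t| ≤ 2 * N ^ 2 * A / |t - e| := by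
  set ℓ : Polynomial ℝ := Polynomial.C ((t - e) / 2) * Polynomial.X + Polynomial.C ((t + e) / 2)
    with hℓ
  have hdeg : (q.comp ℓ).natDegree ≤ N := by
    refine Polynomial.natDegree_comp_le.trans ?_
    have : ℓ.natDegree ≤ 1 := Polynomial.natDegree_linear_le
    calc _ ≤ q.natDegree * 1 := Nat.mul_le_mul_left _ this
      _ ≤ N := by simpa using hq
  have h := abs_eval_derivative_one_le hdeg hA (fun x hx => by
    rw [Polynomial.eval_comp]
    refine hb _ ?_
    have : ℓ.eval x = (1 - x) / 2 * e + (1 + x) / 2 * t := by simp [hℓ]; ring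
    rw [this, ← segment_eq_uIcc]
    exact ⟨(1 - x) / 2, (1 + x) / 2, by linarith [hx.2], by linarith [hx.1], by ring, rfl⟩)
  rw [Polynomial.derivative_comp, Polynomial.eval_mul, Polynomial.eval_comp] at h
  have e1 : ℓ.eval 1 = t := by simp [hℓ]; ring
  have e2 : ℓ.derivative.eval 1 = (t - e) / 2 := by simp [hℓ]
  rw [e1, e2, abs_mul, abs_div, abs_two] at h
  have hpos : 0 < |t - e| := abs_pos.2 (sub_ne_zero.2 het.symm)
  rw [le_div_iff₀ hpos]
  nlinarith

/-- Every `t ∈ [0, δ]` is an endpoint of an interval of length at least `D` ending at the fixed `e`,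
so the endpoint form of Markov's inequality bounds `q'(t)` uniformly. -/
lemma abs_eval_sub_le {N : ℕ} {q : Polynomial ℝ} (hq : q.natDegree ≤ N) {A : ℝ}
    (hA : 0 < A) {e δ D : ℝ} (hδ : 0 ≤ δ) (hD : 0 < D)
    (hdist : ∀ t ∈ Set.Icc 0 δ, D ≤ |t - e| ∧ ∀ x ∈ Set.uIcc e t, |q.eval x| ≤ A) :
    |q.eval 0 - q.eval δ| ≤ 2 * N ^ 2 * A / D * δ := by
  have h := Convex.norm_image_sub_le_of_norm_deriv_le (f := fun x => q.eval x)
    (s := Set.Icc 0 δ) (C := 2 * N ^ 2 * A / D) (fun x _ => q.differentiable x)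
    (fun t ht => by
      rw [Polynomial.deriv]
      obtain ⟨h1, h2⟩ := hdist t ht
      have het : e ≠ t := by
        rintro rfl
        simp at h1
        linarith
      refine (abs_eval_derivative_le hq hA het h2).trans ?_
      gcongr)
    (convex_Icc 0 δ) (Set.right_mem_Icc.2 hδ) (Set.left_mem_Icc.2 hδ)
  simpa [abs_of_nonneg hδ] using h

/-- The restriction of `P` to every line is a polynomial of degree at most `N`. -/
def IsLinePoly (N : ℕ) (P : E d → ℝ) : Prop :=
  ∀ z w : E d, ∃ q : Polynomial ℝ, q.natDegree ≤ N ∧ ∀ t : ℝ, P (z + t • w) = q.eval t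

lemma isLinePoly_const (N : ℕ) (a : ℝ) : IsLinePoly N (fun _ : E d => a) :=
  fun _ _ => ⟨Polynomial.C a, by simp, by simp⟩

lemma IsLinePoly.mono {N N' : ℕ} {P : E d → ℝ} (h : IsLinePoly N P) (hN : N ≤ N') :
    IsLinePoly N' P := fun z w =>
  let ⟨q, hq, he⟩ := h z w
  ⟨q, hq.trans hN, he⟩

lemma isLinePoly_coord (i : Fin d) (a b : ℝ) : IsLinePoly 1 (fun x : E d => a * x i + b) :=
  fun z w => ⟨Polynomial.C (a * w i) * Polynomial.X + Polynomial.C (a * z i + b),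
    Polynomial.natDegree_linear_le, fun t => by simp; ring⟩

lemma IsLinePoly.add {N : ℕ} {P Q : E d → ℝ} (hP : IsLinePoly N P) (hQ : IsLinePoly N Q) :
    IsLinePoly N (fun x => P x + Q x) := fun z w =>
  let ⟨p, hp, hpe⟩ := hP z w
  let ⟨q, hq, hqe⟩ := hQ z w
  ⟨p + q, (Polynomial.natDegree_add_le _ _).trans (max_le hp hq), fun t => by simp [hpe, hqe]⟩

lemma IsLinePoly.mul {N N' : ℕ} {P Q : E d → ℝ} (hP : IsLinePoly N P) (hQ : IsLinePoly N' Q) :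
    IsLinePoly (N + N') (fun x => P x * Q x) := fun z w =>
  let ⟨p, hp, hpe⟩ := hP z w
  let ⟨q, hq, hqe⟩ := hQ z w
  ⟨p * q, Polynomial.natDegree_mul_le.trans (add_le_add hp hq), fun t => by simp [hpe, hqe]⟩

lemma IsLinePoly.const_mul {N : ℕ} {P : E d → ℝ} (a : ℝ) (hP : IsLinePoly N P) :
    IsLinePoly N (fun x => a * P x) := by
  simpa using (isLinePoly_const 0 a).mul hP

lemma IsLinePoly.sum {ι : Type*} {N : ℕ} (s : Finset ι) {P : ι → E d → ℝ}
    (h : ∀ i ∈ s, IsLinePoly N (P i)) : IsLinePoly N (fun x => ∑ i ∈ s, P i x) := by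
  classical
  induction s using Finset.induction_on with
  | empty => simpa using isLinePoly_const N 0
  | insert i s hi ih =>
    simp only [Finset.sum_insert hi]
    exact (h i (by simp)).add (ih fun j hj => h j (by simp [hj]))

lemma IsLinePoly.prod_coord (s : Finset (Fin d)) (a b : Fin d → ℝ) :
    IsLinePoly s.card (fun x : E d => ∏ i ∈ s, (a i * x i + b i)) := by
  induction s using Finset.induction_on with
  | empty => simpa using isLinePoly_const 0 1
  | insert i s hi ih =>
    simp only [Finset.prod_insert hi, Finset.card_insert_of_notMem hi]
    rw [add_comm]
    exact (isLinePoly_coord i _ _).mul ih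

lemma IsLinePoly.comp_sub {N : ℕ} {P : E d → ℝ} (hP : IsLinePoly N P) (c : E d) :
    IsLinePoly N (fun x => P (x - c)) := fun z w =>
  let ⟨q, hq, he⟩ := hP (z - c) w
  ⟨q, hq, fun t => by rw [← he, ← add_sub_right_comm]⟩

lemma isLinePoly_hom (j : ℕ) (g : E d → ℝ) (c : E d) : IsLinePoly j (hom j g c) := by
  induction j generalizing g with
  | zero => exact isLinePoly_const 0 _
  | succ j ih =>
    refine IsLinePoly.sum _ fun i _ => ?_
    have := (isLinePoly_coord i 1 0).mul (ih (dpart i g))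
    simpa [add_comm] using this

lemma isLinePoly_taylorPoly (n : ℕ) (g : E d → ℝ) (c : E d) :
    IsLinePoly (n - 1) (taylorPoly n g c) := by
  refine IsLinePoly.sum _ fun j hj => ?_
  have := ((isLinePoly_hom j g c).comp_sub c).const_mul ((j.factorial : ℝ)⁻¹)
  simp only [inv_mul_eq_div] at this
  exact this.mono (by simp at hj; omega)

/-- A polynomial on a ball is controlled by its values at sufficiently dense points. -/
lemma norming {N : ℕ} {P : E d → ℝ} (hP : IsLinePoly N P) (hc : Continuous P) {c : E d}
    {ρ h κ e : ℝ} (hh : 0 < h) {Z : Set (E d)}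
    (hZ : ∀ x ∈ Metric.closedBall c ρ, ∃ z ∈ Z, ‖z - x‖ ≤ h) (hρ : 5 * h ≤ ρ)
    (h1 : 6 * N ^ 2 * h ≤ κ * (8 / 5 * ρ - 3 * h)) (h2 : 2 * N ^ 2 * h ≤ κ * (3 / 5 * ρ - h))
    (he : ∀ z ∈ Z, z ∈ Metric.closedBall c ρ → |P z| ≤ e) {x : E d}
    (hx : x ∈ Metric.closedBall c ρ) : (1 - κ) * |P x| ≤ e := by
  have hρ0 : 0 < ρ := by linarith
  obtain ⟨z, hz, hmax⟩ := (isCompact_closedBall c ρ).exists_isMaxOn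
    ⟨c, Metric.mem_closedBall_self hρ0.le⟩ (f := fun x => |P x|) (hc.abs.continuousOn)
  have he0 : 0 ≤ e := by
    obtain ⟨x', hx', hx'n⟩ := hZ c (Metric.mem_closedBall_self hρ0.le)
    exact (abs_nonneg _).trans (he x' hx' (by rw [mem_closedBall_iff_norm]; linarith))
  have hκ0 : 0 ≤ κ := by
    by_contra hneg
    push Not at hneg
    have : 0 ≤ 2 * (N : ℝ) ^ 2 * h := by positivity
    nlinarith
  rcases eq_or_lt_of_le (abs_nonneg (P z)) with hA | hA
  · have : |P x| = 0 := le_antisymm (by rw [hA]; exact hmax hx) (abs_nonneg _)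
    rw [this]; simpa using he0
  set A := |P z| with hAdef
  have hbd : ∀ y ∈ Metric.closedBall c ρ, |P y| ≤ A := fun y hy => hmax hy
  -- At a maximum point `z` of `|P|`, a sampling point where `P` has changed by at most `κ A` gives
  -- `A ≤ e + κ A`.
  suffices hs : ∃ y ∈ Z, y ∈ Metric.closedBall c ρ ∧ |P z - P y| ≤ κ * A by
    obtain ⟨y, hyZ, hyb, hyd⟩ := hs
    have h3 := he y hyZ hyb
    have h4 : (1 - κ) * A ≤ e := by
      have := abs_sub_abs_le_abs_sub (P z) (P y)
      linarith
    rcases le_total κ 1 with hκ | hκ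
    · exact (mul_le_mul_of_nonneg_left (hbd x hx) (by linarith)).trans h4
    · exact (mul_nonpos_of_nonpos_of_nonneg (by linarith) (abs_nonneg _)).trans he0
  -- On the line through `z` and `y`, parametrized by arc length from `z`, the parameter `e'` is the
  -- far end of a long chord inside the ball, used as the other endpoint in Markov's inequality.
  have key : ∀ (y : E d) (e' D : ℝ), 0 < ‖y - z‖ → 0 < D → 2 * N ^ 2 * ‖y - z‖ ≤ κ * D →
      (∀ t ∈ Set.Icc 0 ‖y - z‖, D ≤ |t - e'|) → z + e' • (‖y - z‖⁻¹ • (y - z)) ∈ Metric.closedBall c ρ →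
      y ∈ Metric.closedBall c ρ → |P z - P y| ≤ κ * A := by
    intro y e' D hδ hD hκD hdist hend hy
    set δ := ‖y - z‖ with hδdef
    set w := δ⁻¹ • (y - z) with hw
    have hyw : z + δ • w = y := by rw [hw, smul_inv_smul₀ hδ.ne']; abel
    obtain ⟨q, hq, hqe⟩ := hP z w
    have hseg : ∀ a b : ℝ, z + a • w ∈ Metric.closedBall c ρ → z + b • w ∈ Metric.closedBall c ρ →
        ∀ s ∈ Set.uIcc a b, z + s • w ∈ Metric.closedBall c ρ := by
      intro a b ha hb s hs
      rw [← segment_eq_uIcc] at hs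
      obtain ⟨u, v, hu, hv, huv, rfl⟩ := hs
      have := (convex_closedBall c ρ) ha hb hu hv huv
      convert this using 1
      have hv' : v = 1 - u := by linarith
      subst hv'
      simp only [smul_eq_mul]
      module
    have hz0 : z + (0 : ℝ) • w ∈ Metric.closedBall c ρ := by simpa using hz
    have hyδ : z + δ • w ∈ Metric.closedBall c ρ := by rwa [hyw]
    have := abs_eval_sub_le hq hA (e := e') hδ.le hD (fun t ht => ⟨hdist t ht, fun s hs => by
      rw [← hqe]
      refine hbd _ (hseg e' t hend (hseg 0 δ hz0 hyδ t ?_) s hs)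
      rwa [Set.uIcc_of_le hδ.le]⟩)
    rw [← hqe, ← hqe, hyw] at this
    simp only [zero_smul, add_zero] at this
    refine this.trans ?_
    rw [div_mul_eq_mul_div, div_le_iff₀ hD]
    nlinarith
  rw [mem_closedBall_iff_norm] at hz
  set v := z - c with hv
  have hnorm : ∀ (s : ℝ) (u : E d), ‖z + s • u - c‖ ^ 2
      = ‖v‖ ^ 2 + 2 * s * inner ℝ v u + s ^ 2 * ‖u‖ ^ 2 := by
    intro s u
    rw [add_sub_right_comm, ← hv, norm_add_sq_real, inner_smul_right, norm_smul, mul_pow]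
    simp; ring
  have hmem : ∀ y : E d, ‖y - c‖ ^ 2 ≤ ρ ^ 2 → y ∈ Metric.closedBall c ρ := fun y hy => by
    rw [mem_closedBall_iff_norm]
    exact le_of_sq_le_sq hy hρ0.le
  -- When `z` is away from the boundary any nearby sampling point will do: of the two directions
  -- along the line, one does not point outward, and `(4/5)² + (3/5)² = 1` keeps a chord of length
  -- `3/5 ρ` in the ball.
  rcases le_or_gt ‖v‖ (4 / 5 * ρ) with hcase | hcase
  · obtain ⟨y, hyZ, hyn⟩ := hZ z (mem_closedBall_iff_norm.2 hz)
    have hyb : y ∈ Metric.closedBall c ρ := by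
      rw [mem_closedBall_iff_norm]
      calc ‖y - c‖ = ‖(y - z) + v‖ := by rw [hv]; congr 1; abel
        _ ≤ _ := norm_add_le _ _
        _ ≤ ρ := by linarith
    refine ⟨y, hyZ, hyb, ?_⟩
    rcases eq_or_lt_of_le (norm_nonneg (y - z)) with h0 | h0
    · have : y = z := by rw [← sub_eq_zero, ← norm_eq_zero]; exact h0.symm
      rw [this]; simp; positivity
    have hD : 0 < 3 / 5 * ρ - h := by linarith
    have hκD : 2 * N ^ 2 * ‖y - z‖ ≤ κ * (3 / 5 * ρ - h) := le_trans (by gcongr) h2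
    have hwn : ‖‖y - z‖⁻¹ • (y - z)‖ = 1 := by
      rw [norm_smul, norm_inv, norm_norm, inv_mul_cancel₀ h0.ne']
    rcases le_total (inner ℝ v (‖y - z‖⁻¹ • (y - z))) 0 with hs | hs
    · refine key y (3 / 5 * ρ) _ h0 hD hκD (fun t ht => ?_) (hmem _ ?_) hyb
      · rw [abs_sub_comm]
        exact le_trans (by linarith [ht.2]) (le_abs_self _)
      · rw [hnorm, hwn]
        nlinarith [mul_nonneg hρ0.le (neg_nonneg.2 hs), norm_nonneg v]
    · refine key y (-(3 / 5 * ρ)) _ h0 hD hκD (fun t ht => ?_) (hmem _ ?_) hyb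
      · exact le_trans (by linarith [ht.1]) (le_abs_self _)
      · rw [hnorm, hwn]
        nlinarith [mul_nonneg hρ0.le hs, norm_nonneg v]
  · have hv0 : 0 < ‖v‖ := by linarith
    -- Near the boundary the sampling point must lie inward of `z`. Sampling around the point `2h`
    -- inward gives a direction within 30° of the inward normal, since `h / (2h) = sin 30°`, and the
    -- chord then has length at least `8/5 ρ`.
    set z' := z - (2 * h / ‖v‖) • v with hz'
    have hz'n : ‖z' - c‖ = |‖v‖ - 2 * h| := by
      have : z' - c = ((‖v‖ - 2 * h) / ‖v‖) • v := by
        rw [hz', sub_div, div_self hv0.ne', sub_smul, one_smul, hv]; abel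
      rw [this, norm_smul, Real.norm_eq_abs, abs_div, abs_norm, div_mul_cancel₀ _ hv0.ne']
    have hz'b : ‖z' - c‖ ≤ ρ - h := by
      rw [hz'n, abs_le]; constructor <;> linarith
    obtain ⟨y, hyZ, hyn⟩ := hZ z' (mem_closedBall_iff_norm.2 (by linarith))
    have hyb : y ∈ Metric.closedBall c ρ := by
      rw [mem_closedBall_iff_norm]
      calc ‖y - c‖ = ‖(y - z') + (z' - c)‖ := by congr 1; abel
        _ ≤ _ := norm_add_le _ _
        _ ≤ ρ := by linarith
    refine ⟨y, hyZ, hyb, ?_⟩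
    set u := y - z with hu
    have hyz' : y - z' = u + (2 * h / ‖v‖) • v := by rw [hz', hu]; abel
    have hsm : ‖(2 * h / ‖v‖) • v‖ = 2 * h := by
      rw [norm_smul, Real.norm_of_nonneg (by positivity), div_mul_cancel₀ _ hv0.ne']
    have hδ3 : ‖u‖ ≤ 3 * h := by
      calc ‖u‖ = ‖(y - z') - (2 * h / ‖v‖) • v‖ := by rw [hyz', add_sub_cancel_right]
        _ ≤ _ := norm_sub_le _ _
        _ ≤ 3 * h := by rw [hsm]; linarith
    have hδ1 : h ≤ ‖u‖ := by
      have := norm_sub_norm_le ((2 * h / ‖v‖) • v) (-u)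
      rw [sub_neg_eq_add, add_comm, ← hyz', hsm, norm_neg] at this
      linarith
    have h0 : 0 < ‖u‖ := by linarith
    have hin : 4 * h * inner ℝ v u ≤ - ‖v‖ * (‖u‖ ^ 2 + 3 * h ^ 2) := by
      have h5 : ‖y - z'‖ ^ 2 ≤ h ^ 2 := by gcongr
      rw [hyz', norm_add_sq_real, hsm, inner_smul_right, real_inner_comm] at h5
      have h6 : 2 * h / ‖v‖ * inner ℝ v u * ‖v‖ = 2 * h * inner ℝ v u := by
        field_simp
      nlinarith
    -- Here `433/500` is just below `cos 30° = √3/2`; the bound follows from `‖u‖² + 3h² ≥ 2√3 h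
    -- ‖u‖`.
    have hin2 : inner ℝ v (‖u‖⁻¹ • u) ≤ -(433 / 500) * ‖v‖ := by
      rw [inner_smul_right, inv_mul_le_iff₀ h0]
      have h7 : 0 ≤ ‖v‖ * (‖u‖ ^ 2 + 3 * h ^ 2 - 433 / 125 * h * ‖u‖) := by
        refine mul_nonneg hv0.le ?_
        nlinarith [sq_nonneg (‖u‖ - 433 / 250 * h)]
      have h8 : h * inner ℝ v u ≤ h * (‖u‖ * (-(433 / 500) * ‖v‖)) := by nlinarith
      exact le_of_mul_le_mul_left h8 hh
    have hD : 0 < 8 / 5 * ρ - 3 * h := by linarith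
    have hwn : ‖‖u‖⁻¹ • u‖ = 1 := by
      rw [norm_smul, norm_inv, norm_norm, inv_mul_cancel₀ h0.ne']
    refine key y (8 / 5 * ρ) _ h0 hD ?_ (fun t ht => ?_) (hmem _ ?_) hyb
    · refine le_trans ?_ h1
      have : (0 : ℝ) ≤ (N : ℝ) ^ 2 := by positivity
      nlinarith
    · rw [abs_sub_comm]
      exact le_trans (by linarith [ht.2]) (le_abs_self _)
    · rw [hnorm, hwn]
      have h9 : 2 * (8 / 5 * ρ) * inner ℝ v (‖u‖⁻¹ • u)
          ≤ 2 * (8 / 5 * ρ) * (-(433 / 500) * ‖v‖) :=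
        mul_le_mul_of_nonneg_left hin2 (by linarith)
      have h10 := mul_nonneg (sub_nonneg.2 hz) (sub_nonneg.2 hcase.le)
      have h11 := mul_nonneg hρ0.le (sub_nonneg.2 hcase.le)
      have h12 := sq_nonneg ρ
      ring_nf at h9 h10 h11 h12 ⊢
      linarith

/-! ### Multilinear interpolation on a cube inscribed in a ball. -/

/-- The point `x` with its `i`-th coordinate replaced by `a`. -/
def setCoord (x : E d) (i : Fin d) (a : ℝ) : E d := WithLp.toLp 2 (Function.update x i a)

@[simp] lemma setCoord_apply (x : E d) (i j : Fin d) (a : ℝ) :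
    setCoord x i a j = if j = i then a else x j := by
  simp [setCoord, Function.update_apply]

lemma setCoord_self (x : E d) (i : Fin d) : setCoord x i (x i) = x := by
  ext j; simp; rintro rfl; rfl

lemma hasDerivAt_setCoord {φ : E d → ℝ} {x : E d} {i : Fin d} {a : ℝ}
    (h : DifferentiableAt ℝ φ (setCoord x i a)) :
    HasDerivAt (fun t => φ (setCoord x i t)) (dpart i φ (setCoord x i a)) a := by
  have h1 : HasDerivAt (fun t => setCoord x i t) (EuclideanSpace.single i 1 : E d) a := by
    have : (fun t => setCoord x i t)
        = fun t => setCoord x i 0 + t • (EuclideanSpace.single i 1 : E d) := by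
      funext t; ext j; by_cases hj : j = i <;> simp [hj]
    rw [this]
    simpa using ((hasDerivAt_id a).smul_const (EuclideanSpace.single i 1 : E d)).const_add
      (setCoord x i 0)
  exact h.hasFDerivAt.comp_hasDerivAt a h1

/-- The error of linear interpolation at the nodes `s` and `-s`. -/
lemma abs_sub_linear_interp_le {ψ ψ' ψ'' : ℝ → ℝ} {a s ρ K : ℝ} (hs : 0 < s) (hsρ : s ≤ ρ)
    (haρ : |a| ≤ ρ)
    (h1 : ∀ t, |t| ≤ max |a| s → HasDerivAt ψ (ψ' t) t)
    (h2 : ∀ t, |t| ≤ max |a| s → HasDerivAt ψ' (ψ'' t) t)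
    (hK : ∀ t, |t| ≤ max |a| s → |ψ'' t| ≤ K) :
    |ψ a - ((1 + a / s) / 2 * ψ s + (1 - a / s) / 2 * ψ (-s))| ≤ K * ρ ^ 2 / 2 := by
  have hK0 : 0 ≤ K := (abs_nonneg _).trans (hK a (le_max_left _ _))
  -- the function `K t² / 2 ± ψ` is convex
  have conv (ε : ℝ) (hε : |ε| = 1) :
      ConvexOn ℝ (Set.Icc (-(max |a| s)) (max |a| s)) (fun t => K * t ^ 2 / 2 + ε * ψ t) := by
    refine convexOn_of_hasDerivWithinAt2_nonneg (f' := fun t => K * t + ε * ψ' t)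
      (f'' := fun t => K + ε * ψ'' t) (convex_Icc _ _) ?_ ?_ ?_ ?_
    · intro t ht
      exact (((hasDerivAt_pow 2 t).const_mul K).div_const 2 |>.add
        ((h1 t (abs_le.2 ht)).const_mul ε)).continuousAt.continuousWithinAt
    · intro t ht
      have ht' := interior_subset ht
      refine HasDerivAt.hasDerivWithinAt ?_
      refine ((((hasDerivAt_pow 2 t).const_mul K).div_const 2).add
        ((h1 t (abs_le.2 ht')).const_mul ε)).congr_deriv ?_
      simp; ring
    · intro t ht
      have ht' := interior_subset ht
      refine HasDerivAt.hasDerivWithinAt ?_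
      refine (((hasDerivAt_id t).const_mul K).add
        ((h2 t (abs_le.2 ht')).const_mul ε)).congr_deriv ?_
      simp
    · intro t ht
      have ht' := interior_subset ht
      have := hK t (abs_le.2 ht')
      have h3 : |ε * ψ'' t| ≤ K := by rw [abs_mul, hε, one_mul]; exact this
      linarith [neg_abs_le (ε * ψ'' t)]
  have conv' (ε : ℝ) (hε : |ε| = 1) (x y : ℝ) (hx : x ∈ Set.Icc (-(max |a| s)) (max |a| s))
      (hy : y ∈ Set.Icc (-(max |a| s)) (max |a| s)) (u v : ℝ) (hu : 0 ≤ u) (hv : 0 ≤ v)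
      (huv : u + v = 1) : K * (u * x + v * y) ^ 2 / 2 + ε * ψ (u * x + v * y)
        ≤ u * (K * x ^ 2 / 2 + ε * ψ x) + v * (K * y ^ 2 / 2 + ε * ψ y) :=
    (conv ε hε).2 hx hy hu hv huv
  have hm : s ≤ max |a| s := le_max_right _ _
  have hma : |a| ≤ max |a| s := le_max_left _ _
  have mem (t : ℝ) (ht : |t| ≤ max |a| s) : t ∈ Set.Icc (-(max |a| s)) (max |a| s) := abs_le.1 ht
  have hsm := mem s (by rwa [abs_of_pos hs])
  have hsm' := mem (-s) (by rwa [abs_neg, abs_of_pos hs])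
  have ham := mem a hma
  have hs2 : s ^ 2 ≤ ρ ^ 2 := by gcongr
  have ha2 : a ^ 2 ≤ ρ ^ 2 := sq_le_sq' (by linarith [abs_le.1 haρ]) (abs_le.1 haρ).2
  set I := (1 + a / s) / 2 * ψ s + (1 - a / s) / 2 * ψ (-s) with hI
  -- the sign of the error is that of `a² - s²`
  have main (ε : ℝ) (hε : |ε| = 1) : ε * (ψ a - I) ≤ K * ρ ^ 2 / 2 := by
    rcases le_or_gt |a| s with has | has
    · have h := conv' ε hε _ _ hsm hsm' ((1 + a / s) / 2) ((1 - a / s) / 2)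
        (by have : -1 ≤ a / s := by rw [le_div_iff₀ hs]; linarith [(abs_le.1 has).1]
            linarith)
        (by have : a / s ≤ 1 := by rw [div_le_iff₀ hs]; linarith [(abs_le.1 has).2]
            linarith) (by ring)
      have e1 : (1 + a / s) / 2 * s + (1 - a / s) / 2 * (-s) = a := by field_simp; ring
      simp only [e1] at h
      have : ε * (ψ a - I) ≤ K * s ^ 2 / 2 - K * a ^ 2 / 2 := by
        rw [hI]
        linear_combination h
      nlinarith [sq_nonneg a]
    -- For extrapolation, the node nearer to `a` is a convex combination of `a` and the other node.
    -- Convexity is applied there with the opposite sign and solved for `ψ a`.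
    · rcases le_or_gt 0 a with ha0 | ha0
      · rw [abs_of_nonneg ha0] at has
        have h := conv' (-ε) (by rwa [abs_neg]) _ _ ham hsm' (2 * s / (a + s))
          ((a - s) / (a + s)) (by positivity) (div_nonneg (by linarith) (by linarith))
          (by field_simp; ring)
        have hne : a + s ≠ 0 := by positivity
        have e1 : 2 * s / (a + s) * a + (a - s) / (a + s) * (-s) = s := by field_simp; ring
        simp only [e1] at h
        have h' := mul_le_mul_of_nonneg_left h (show 0 ≤ (a + s) / (2 * s) by positivity)
        have : ε * (ψ a - I) ≤ K * a ^ 2 / 2 - K * s ^ 2 / 2 := by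
          rw [hI]
          have e2 : (a + s) / (2 * s) * (2 * s / (a + s) * (K * a ^ 2 / 2 + -ε * ψ a) +
            (a - s) / (a + s) * (K * (-s) ^ 2 / 2 + -ε * ψ (-s))) =
            (K * a ^ 2 / 2 + -ε * ψ a) + (a - s) / (2 * s) * (K * (-s) ^ 2 / 2 + -ε * ψ (-s)) := by
            field_simp
          rw [e2] at h'
          have e3 : (a + s) / (2 * s) = (1 + a / s) / 2 := by field_simp; ring
          have e4 : (a - s) / (2 * s) = -((1 - a / s) / 2) := by field_simp; ring
          rw [e3, e4] at h'
          linear_combination h'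
        nlinarith [sq_nonneg s]
      · rw [abs_of_neg ha0] at has
        have h := conv' (-ε) (by rwa [abs_neg]) _ _ ham hsm (2 * s / (-a + s))
          ((-a - s) / (-a + s)) (div_nonneg (by linarith) (by linarith))
          (div_nonneg (by linarith) (by linarith))
          (by have : -a + s ≠ 0 := by linarith
              field_simp; ring)
        have hne : -a + s ≠ 0 := by linarith
        have e1 : 2 * s / (-a + s) * a + (-a - s) / (-a + s) * s = -s := by field_simp; ring
        simp only [e1] at h
        have h' := mul_le_mul_of_nonneg_left h
          (show 0 ≤ (-a + s) / (2 * s) from div_nonneg (by linarith) (by linarith))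
        have : ε * (ψ a - I) ≤ K * a ^ 2 / 2 - K * s ^ 2 / 2 := by
          rw [hI]
          have e2 : (-a + s) / (2 * s) * (2 * s / (-a + s) * (K * a ^ 2 / 2 + -ε * ψ a) +
            (-a - s) / (-a + s) * (K * s ^ 2 / 2 + -ε * ψ s)) =
            (K * a ^ 2 / 2 + -ε * ψ a) + (-a - s) / (2 * s) * (K * s ^ 2 / 2 + -ε * ψ s) := by
            field_simp
          rw [e2] at h'
          have e3 : (-a + s) / (2 * s) = (1 - a / s) / 2 := by field_simp; ring
          have e4 : (-a - s) / (2 * s) = -((1 + a / s) / 2) := by field_simp; ring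
          rw [e3, e4] at h'
          linear_combination h'
        nlinarith [sq_nonneg s]
  rw [abs_le]
  constructor
  · have := main (-1) (by simp); linarith
  · have := main 1 (by simp); linarith

/-- The point `x` with the coordinates in `W` replaced by `s` (on `A`) and `-s` (off `A`). -/
def vertex (W A : Finset (Fin d)) (s : ℝ) (x : E d) : E d :=
  WithLp.toLp 2 fun j => if j ∈ W then (if j ∈ A then s else -s) else x j

/-- The weight of a vertex in multilinear interpolation. -/
def vertexWeight (W A : Finset (Fin d)) (s : ℝ) (x : E d) : ℝ :=
  ∏ c ∈ W, (1 + (if c ∈ A then x c else -x c) / s) / 2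

/-- Multilinear interpolation in the coordinates in `W`, at the nodes `s` and `-s`. -/
def interp (W : Finset (Fin d)) (s : ℝ) (ψ : E d → ℝ) (x : E d) : ℝ :=
  ∑ A ∈ W.powerset, vertexWeight W A s x * ψ (vertex W A s x)

lemma interp_insert {W : Finset (Fin d)} {c : Fin d} (hc : c ∉ W) (s : ℝ) (ψ : E d → ℝ) (x : E d) :
    interp (insert c W) s ψ x = (1 + x c / s) / 2 * interp W s ψ (setCoord x c s) +
      (1 - x c / s) / 2 * interp W s ψ (setCoord x c (-s)) := by
  unfold interp
  rw [Finset.sum_powerset_insert hc, add_comm, Finset.mul_sum, Finset.mul_sum]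
  have hne {e : Fin d} (he : e ∈ W) : e ≠ c := fun h => hc (h ▸ he)
  refine congrArg₂ (· + ·) (Finset.sum_congr rfl fun A hA => ?_)
    (Finset.sum_congr rfl fun A hA => ?_)
  · have hcA : c ∉ A := fun h => hc (Finset.mem_powerset.1 hA h)
    have h1 : vertex (insert c W) (insert c A) s x = vertex W A s (setCoord x c s) := by
      ext j
      by_cases hj : j = c
      · subst hj; simp [vertex, hc]
      · simp [vertex, hj]
    have h2 : vertexWeight (insert c W) (insert c A) s x
        = (1 + x c / s) / 2 * vertexWeight W A s (setCoord x c s) := by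
      unfold vertexWeight
      rw [Finset.prod_insert hc]
      simp only [Finset.mem_insert_self, if_true]
      congr 1
      refine Finset.prod_congr rfl fun e he => ?_
      simp [hne he]
    rw [h1, h2, mul_assoc]
  · have hcA : c ∉ A := fun h => hc (Finset.mem_powerset.1 hA h)
    have h1 : vertex (insert c W) A s x = vertex W A s (setCoord x c (-s)) := by
      ext j
      by_cases hj : j = c
      · subst hj; simp [vertex, hc, hcA]
      · simp [vertex, hj]
    have h2 : vertexWeight (insert c W) A s x
        = (1 - x c / s) / 2 * vertexWeight W A s (setCoord x c (-s)) := by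
      unfold vertexWeight
      rw [Finset.prod_insert hc]
      simp only [hcA, if_false]
      congr 1
      · ring
      refine Finset.prod_congr rfl fun e he => ?_
      simp [hne he]
    rw [h1, h2, mul_assoc]

/-- Coordinates are interpolated one at a time. Each step adds a one-variable error and multiplies
earlier errors by `max 1 (|w c| / s)`, the sum of the absolute weights. The order matters because
`ψ` is controlled only on the ball. -/
lemma interp_error {V : Finset (Fin d)} {s ρ : ℝ} (hs : 0 < s) (hρ : 0 < ρ)
    (hV : V.card * s ^ 2 ≤ ρ ^ 2) {ψ : E d → ℝ} {K : Fin d → ℝ} (hK : ∀ c, 0 ≤ K c)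
    (h1 : ∀ w, ‖w‖ ≤ ρ → DifferentiableAt ℝ ψ w)
    (h2 : ∀ c ∈ V, ∀ w, ‖w‖ ≤ ρ → DifferentiableAt ℝ (dpart c ψ) w)
    (h3 : ∀ c ∈ V, ∀ w, ‖w‖ ≤ ρ → |dpart c (dpart c ψ) w| ≤ K c) (W : Finset (Fin d)) :
    W ⊆ V → ∀ w : E d, (∀ j ∉ V, w j = 0) → (∀ j ∈ V, j ∉ W → |w j| ≤ s) → ‖w‖ ≤ ρ →
      |ψ w - interp W s ψ w| ≤ (∏ c ∈ W, max 1 (|w c| / s)) * ∑ c ∈ W, K c * ρ ^ 2 / 2 := by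
  have normsq (w : E d) : ‖w‖ ^ 2 = ∑ j, |w j| ^ 2 := by
    rw [EuclideanSpace.norm_sq_eq]; simp
  have small (w : E d) (hw0 : ∀ j ∉ V, w j = 0) (hws : ∀ j ∈ V, |w j| ≤ s) : ‖w‖ ≤ ρ := by
    refine le_of_sq_le_sq ?_ hρ.le
    rw [normsq, ← Finset.sum_subset (Finset.subset_univ V) (fun j _ hj => by simp [hw0 j hj])]
    refine le_trans (Finset.sum_le_sum fun j hj => pow_le_pow_left₀ (abs_nonneg _) (hws j hj) 2) ?_
    simpa using hV
  induction W using Finset.strongInduction with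
  | H W ih =>
    intro hWV w hw0 hws hwρ
    rcases W.eq_empty_or_nonempty with rfl | hne
    · have : vertex ∅ ∅ s w = w := by ext j; simp [vertex]
      simp [interp, vertexWeight, this]
    -- A coordinate exceeding `s` is treated first: moving it to `±s` decreases the norm. Once none
    -- is left, all points involved lie in the cube of half-side `s`, which is contained in the
    -- ball.
    obtain ⟨c, hcW, hcbig⟩ : ∃ c ∈ W, s < |w c| ∨ ∀ j ∈ W, |w j| ≤ s := by
      by_cases h : ∃ c ∈ W, s < |w c|
      · obtain ⟨c, hc, h⟩ := h; exact ⟨c, hc, Or.inl h⟩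
      · push Not at h; obtain ⟨c, hc⟩ := hne; exact ⟨c, hc, Or.inr h⟩
    have hcV := hWV hcW
    have hsρ : s ≤ ρ := by
      refine le_of_sq_le_sq (le_trans ?_ hV) hρ.le
      have : (1 : ℝ) ≤ V.card := by exact_mod_cast Finset.card_pos.2 ⟨c, hcV⟩
      nlinarith [sq_nonneg s]
    have hzero (t : ℝ) : ∀ j ∉ V, setCoord w c t j = 0 := fun j hj => by
      have : j ≠ c := fun h => hj (h ▸ hcV)
      simp [this, hw0 j hj]
    have hball (t : ℝ) (ht : |t| ≤ max |w c| s) : ‖setCoord w c t‖ ≤ ρ := by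
      rcases hcbig with hb | hb
      · rw [max_eq_left hb.le] at ht
        refine le_trans (le_of_sq_le_sq ?_ (norm_nonneg w)) hwρ
        rw [normsq, normsq]
        refine Finset.sum_le_sum fun j _ => pow_le_pow_left₀ (abs_nonneg _) ?_ 2
        by_cases hj : j = c
        · subst hj; simpa using ht
        · simp [hj]
      · rw [max_eq_right (hb c hcW)] at ht
        refine small _ (hzero t) fun j hj => ?_
        by_cases hj' : j = c
        · subst hj'; simpa using ht
        · simp only [setCoord_apply, hj', if_false]
          by_cases hjW : j ∈ W
          · exact hb j hjW
          · exact hws j hj hjW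
    have hwc : |w c| ≤ ρ := by
      simpa using (PiLp.norm_apply_le w c).trans hwρ
    have e1 := abs_sub_linear_interp_le (ψ := fun t => ψ (setCoord w c t))
      (ψ' := fun t => dpart c ψ (setCoord w c t))
      (ψ'' := fun t => dpart c (dpart c ψ) (setCoord w c t)) (a := w c) hs hsρ hwc
      (fun t ht => hasDerivAt_setCoord (h1 _ (hball t ht)))
      (fun t ht => hasDerivAt_setCoord (h2 c hcV _ (hball t ht)))
      (fun t ht => h3 c hcV _ (hball t ht))
    simp only [setCoord_self] at e1
    set W' := W.erase c with hW'
    have hcW' : c ∉ W' := Finset.notMem_erase c W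
    have hWins : W = insert c W' := (Finset.insert_erase hcW).symm
    have hprod (t : ℝ) : ∏ e ∈ W', max 1 (|setCoord w c t e| / s)
        = ∏ e ∈ W', max 1 (|w e| / s) := Finset.prod_congr rfl fun e he => by
      have : e ≠ c := fun h => hcW' (h ▸ he)
      simp [this]
    have e2 (t : ℝ) (ht : |t| = s) := ih W' (Finset.erase_ssubset hcW)
      ((Finset.erase_subset _ _).trans hWV) (setCoord w c t) (hzero t) (fun j hj hjW' => by
        by_cases hj' : j = c
        · subst hj'; simp [ht]
        · simp only [setCoord_apply, hj', if_false]
          exact hws j hj fun h => hjW' (Finset.mem_erase.2 ⟨hj', h⟩))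
        (hball t (by rw [ht]; exact le_max_right _ _))
    have e2p := e2 s (abs_of_pos hs)
    have e2m := e2 (-s) (by rw [abs_neg, abs_of_pos hs])
    rw [hprod] at e2p e2m
    rw [hWins, interp_insert hcW', Finset.prod_insert hcW', Finset.sum_insert hcW']
    set Q := ∏ e ∈ W', max 1 (|w e| / s) with hQ
    set S := ∑ e ∈ W', K e * ρ ^ 2 / 2 with hS
    set μ := max 1 (|w c| / s) with hμ
    have hQ1 : 1 ≤ Q := by
      rw [hQ]
      exact Finset.one_le_prod (s := W') fun e _ => le_max_left 1 (|w e| / s)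
    have hμ1 : 1 ≤ μ := le_max_left _ _
    have hS0 : 0 ≤ S := Finset.sum_nonneg fun e _ => by have := hK e; positivity
    have hKc : 0 ≤ K c * ρ ^ 2 / 2 := by have := hK c; positivity
    have hlam : |(1 + w c / s) / 2| + |(1 - w c / s) / 2| ≤ μ := by
      have hr : |w c| / s = |w c / s| := by rw [abs_div, abs_of_pos hs]
      rw [hμ, hr]
      rcases abs_cases ((1 + w c / s) / 2) with ⟨h, _⟩ | ⟨h, _⟩ <;>
      rcases abs_cases ((1 - w c / s) / 2) with ⟨h', _⟩ | ⟨h', _⟩ <;> rw [h, h']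
      · exact le_trans (by linarith) (le_max_left _ _)
      · exact le_trans (by linarith [le_abs_self (w c / s)]) (le_max_right _ _)
      · exact le_trans (by linarith [neg_abs_le (w c / s)]) (le_max_right _ _)
      · exact le_trans (by linarith) (le_max_left _ _)
    set lp := (1 + w c / s) / 2
    set lm := (1 - w c / s) / 2
    have split : ψ w - (lp * interp W' s ψ (setCoord w c s) + lm * interp W' s ψ (setCoord w c (-s)))
        = (ψ w - (lp * ψ (setCoord w c s) + lm * ψ (setCoord w c (-s)))) +
          (lp * (ψ (setCoord w c s) - interp W' s ψ (setCoord w c s)) +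
           lm * (ψ (setCoord w c (-s)) - interp W' s ψ (setCoord w c (-s)))) := by ring
    rw [split]
    calc _ ≤ K c * ρ ^ 2 / 2 + (|lp| * (Q * S) + |lm| * (Q * S)) := by
          refine (abs_add_le _ _).trans (add_le_add e1 ((abs_add_le _ _).trans ?_))
          rw [abs_mul, abs_mul]
          gcongr
      _ ≤ K c * ρ ^ 2 / 2 + μ * (Q * S) := by
          rw [← add_mul]
          gcongr
      _ ≤ μ * Q * (K c * ρ ^ 2 / 2 + S) := by
          have : 1 ≤ μ * Q := one_le_mul_of_one_le_of_one_le hμ1 hQ1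
          nlinarith

/-- From `x ≤ exp (x - 1)` at `x = t / e` one gets `t ≤ exp (t / e)`, and `1 / e ≤ 3/8`. -/
lemma max_one_le_exp {t : ℝ} (ht : 0 ≤ t) : max 1 t ≤ Real.exp (3 / 8 * t) := by
  refine max_le (Real.one_le_exp (by positivity)) ?_
  have h1 : t * Real.exp (-1) ≤ Real.exp (t * Real.exp (-1) - 1) := by
    have := Real.add_one_le_exp (t * Real.exp (-1) - 1); linarith
  have h2 : t ≤ Real.exp (t * Real.exp (-1)) := by
    rw [Real.exp_sub, Real.exp_neg, ← div_eq_mul_inv] at h1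
    have := Real.exp_pos 1
    rw [Real.exp_neg, ← div_eq_mul_inv]
    exact (div_le_div_iff_of_pos_right this).1 h1
  refine h2.trans (Real.exp_le_exp.2 ?_)
  have h3 : Real.exp (-1) ≤ 3 / 8 := by
    rw [Real.exp_neg]
    have := Real.exp_one_gt_d9
    rw [inv_le_comm₀ (Real.exp_pos 1) (by norm_num)]
    linarith
  nlinarith

lemma exp_three_eighths_le : Real.exp (3 / 8) ≤ 3 / 2 := by
  refine le_of_pow_le_pow_left₀ (n := 8) (by norm_num) (by norm_num) ?_
  rw [← Real.exp_nat_mul]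
  have : ((8 : ℕ) : ℝ) * (3 / 8) = (3 : ℕ) * 1 := by norm_num
  rw [this, Real.exp_nat_mul]
  have := Real.exp_one_lt_d9
  calc Real.exp 1 ^ 3 ≤ 2.7182818286 ^ 3 := by gcongr
    _ ≤ _ := by norm_num

/-- The exponential bound applied to `(w c / s)²` turns the product into the exponential of a sum,
which the hypothesis bounds. Then `exp (3/8) ≤ 3/2 ≤ (49/40)²`. -/
lemma prod_max_le {V : Finset (Fin d)} {s : ℝ} (hs : 0 < s) {w : E d}
    (hw : ∑ c ∈ V, w c ^ 2 ≤ V.card * s ^ 2) :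
    ∏ c ∈ V, max 1 (|w c| / s) ≤ (49 / 40) ^ V.card := by
  have h0 : ∀ c ∈ V, 0 ≤ max 1 (|w c| / s) := fun c _ => zero_le_one.trans (le_max_left _ _)
  refine le_of_sq_le_sq ?_ (by positivity)
  calc (∏ c ∈ V, max 1 (|w c| / s)) ^ 2 = ∏ c ∈ V, (max 1 (|w c| / s)) ^ 2 :=
        (Finset.prod_pow _ _ _).symm
    _ ≤ ∏ c ∈ V, Real.exp (3 / 8 * (w c ^ 2 / s ^ 2)) := by
        refine Finset.prod_le_prod (fun c _ => sq_nonneg _) fun c _ => ?_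
        refine le_trans ?_ (max_one_le_exp (by positivity))
        rcases max_cases 1 (|w c| / s) with ⟨h, _⟩ | ⟨h, _⟩ <;> rw [h]
        · simp
        · rw [div_pow, sq_abs]; exact le_max_right _ _
    _ = Real.exp (3 / 8 * ((∑ c ∈ V, w c ^ 2) / s ^ 2)) := by
        rw [← Real.exp_sum, ← Finset.mul_sum, Finset.sum_div]
    _ ≤ Real.exp (V.card * (3 / 8)) := by
        refine Real.exp_le_exp.2 ?_
        have : (∑ c ∈ V, w c ^ 2) / s ^ 2 ≤ V.card := by
          rw [div_le_iff₀ (by positivity)]; exact hw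
        linarith
    _ = Real.exp (3 / 8) ^ V.card := Real.exp_nat_mul _ _
    _ ≤ (3 / 2) ^ V.card := by gcongr; exact exp_three_eighths_le
    _ ≤ _ := by
        rw [← pow_mul, mul_comm, pow_mul]
        gcongr
        norm_num

lemma dpart_comp_add (c : E d) (i : Fin d) (φ : E d → ℝ) :
    dpart i (fun w => φ (c + w)) = fun w => dpart i φ (c + w) := by
  funext w
  simp only [dpart]
  rw [fderiv_comp_add_left]

lemma abs_sub_setCoord_zero_le {ψ : E d → ℝ} {ρ L : ℝ} {a : Fin d}
    (h1 : ∀ w, ‖w‖ ≤ ρ → DifferentiableAt ℝ ψ w) (hL : ∀ w, ‖w‖ ≤ ρ → |dpart a ψ w| ≤ L)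
    {w : E d} (hw : ‖w‖ ≤ ρ) : ‖setCoord w a 0‖ ≤ ρ ∧ |ψ w - ψ (setCoord w a 0)| ≤ L * ρ := by
  have hwa : |w a| ≤ ρ := by simpa using (PiLp.norm_apply_le w a).trans hw
  have hL0 : 0 ≤ L := (abs_nonneg _).trans (hL w hw)
  have hball (t : ℝ) (ht : |t| ≤ |w a|) : ‖setCoord w a t‖ ≤ ρ := by
    refine le_trans (le_of_sq_le_sq ?_ (norm_nonneg w)) hw
    rw [EuclideanSpace.norm_sq_eq, EuclideanSpace.norm_sq_eq]
    refine Finset.sum_le_sum fun j _ => pow_le_pow_left₀ (norm_nonneg _) ?_ 2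
    by_cases hj : j = a
    · subst hj; simpa using ht
    · simp [hj]
  refine ⟨hball 0 (by simp), ?_⟩
  have hmem : ∀ t ∈ Set.uIcc 0 (w a), |t| ≤ |w a| := fun t ht => by
    have := Set.abs_sub_left_of_mem_uIcc ht
    simpa using this
  have h := Convex.norm_image_sub_le_of_norm_hasDerivWithin_le
    (f := fun t => ψ (setCoord w a t)) (s := Set.uIcc 0 (w a)) (C := L)
    (fun t ht => (hasDerivAt_setCoord (h1 _ (hball t (hmem t ht)))).hasDerivWithinAt)
    (fun t ht => hL _ (hball t (hmem t ht))) (convex_uIcc _ _) Set.left_mem_uIcc Set.right_mem_uIcc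
  simp only [setCoord_self, sub_zero, Real.norm_eq_abs] at h
  exact h.trans (by gcongr)

/-- A function whose pure second derivatives are controlled is close to a multilinear polynomial. -/
lemma exists_multilinear_approx {ψ : E d → ℝ} {ρ : ℝ} (hρ : 0 < ρ) {a b : Fin d} (hab : a ≠ b)
    (hd : 3 ≤ d) {K : Fin d → ℝ} (hK : ∀ c, 0 ≤ K c) {La Lb : ℝ}
    (h1 : ∀ w, ‖w‖ ≤ ρ → DifferentiableAt ℝ ψ w)
    (h2 : ∀ c, c ≠ a → c ≠ b → ∀ w, ‖w‖ ≤ ρ → DifferentiableAt ℝ (dpart c ψ) w)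
    (h3 : ∀ c, c ≠ a → c ≠ b → ∀ w, ‖w‖ ≤ ρ → |dpart c (dpart c ψ) w| ≤ K c)
    (hLa : ∀ w, ‖w‖ ≤ ρ → |dpart a ψ w| ≤ La) (hLb : ∀ w, ‖w‖ ≤ ρ → |dpart b ψ w| ≤ Lb) :
    ∃ P : E d → ℝ, Continuous P ∧ IsLinePoly (d - 2) P ∧ ∀ w, ‖w‖ ≤ ρ →
      |ψ w - P w| ≤ (La + Lb) * ρ +
        (49 / 40) ^ (d - 2) * (∑ c ∈ (Finset.univ.erase a).erase b, K c * ρ ^ 2 / 2) := by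
  set V : Finset (Fin d) := (Finset.univ.erase a).erase b with hV
  have hcard : V.card = d - 2 := by
    rw [hV, Finset.card_erase_of_mem (by simp [hab.symm]), Finset.card_erase_of_mem (by simp)]
    simp; omega
  have hn0 : (0 : ℝ) < V.card := by rw [hcard]; exact_mod_cast (by omega : 0 < d - 2)
  have memV (c : Fin d) : c ∈ V ↔ c ≠ a ∧ c ≠ b := by simp [hV, and_comm]
  -- The cube of half-side `s` in the coordinates `V` has its vertices on the sphere of radius `ρ`.
  set s := ρ / √(V.card : ℝ) with hs
  have hs0 : 0 < s := by positivity
  have hVs : V.card * s ^ 2 = ρ ^ 2 := by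
    rw [hs, div_pow, Real.sq_sqrt hn0.le]; field_simp
  refine ⟨fun w => ∑ A ∈ V.powerset, ψ (vertex V A s 0) * vertexWeight V A s w, ?_, ?_, ?_⟩
  · unfold vertexWeight
    refine continuous_finsetSum _ fun A _ => continuous_const.mul
      (continuous_finsetProd _ fun c _ => ?_)
    split_ifs <;> fun_prop
  · refine IsLinePoly.sum _ fun A _ => IsLinePoly.const_mul _ ?_
    rw [← hcard]
    have := IsLinePoly.prod_coord V (fun c => (if c ∈ A then 1 else -1) / s / 2) (fun _ => 1 / 2)
    convert this using 2 with w
    refine Finset.prod_congr rfl fun c _ => ?_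
    split_ifs <;> ring
  · intro w hw
    obtain ⟨hwa, ea⟩ := abs_sub_setCoord_zero_le h1 hLa hw
    obtain ⟨hwb, eb⟩ := abs_sub_setCoord_zero_le h1 hLb hwa
    set w' := setCoord (setCoord w a 0) b 0 with hw'
    have hw'V (c : Fin d) (hc : c ∈ V) : w' c = w c := by
      rw [memV] at hc; simp [hw', hc.1, hc.2]
    have hw'0 : ∀ j ∉ V, w' j = 0 := by
      intro j hj
      rw [memV] at hj
      by_cases hja : j = a
      · simp [hw', hja]
      · have : j = b := by_contra fun h => hj ⟨hja, h⟩
        simp [hw', this]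
    have ei := interp_error hs0 hρ hVs.le hK h1 (fun c hc => h2 c ((memV c).1 hc).1 ((memV c).1 hc).2)
      (fun c hc => h3 c ((memV c).1 hc).1 ((memV c).1 hc).2) V subset_rfl w' hw'0
      (fun j hj hj' => absurd hj hj') hwb
    have hpr := prod_max_le (V := V) hs0 (w := w') (by
      rw [hVs]
      calc ∑ c ∈ V, w' c ^ 2 ≤ ∑ c, w' c ^ 2 :=
            Finset.sum_le_sum_of_subset_of_nonneg (Finset.subset_univ _) fun _ _ _ => sq_nonneg _
        _ = ‖w'‖ ^ 2 := by rw [EuclideanSpace.norm_sq_eq]; simp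
        _ ≤ ρ ^ 2 := by gcongr)
    have hint : interp V s ψ w' = ∑ A ∈ V.powerset, ψ (vertex V A s 0) * vertexWeight V A s w := by
      refine Finset.sum_congr rfl fun A _ => ?_
      have e1 : vertex V A s w' = vertex V A s 0 := by
        ext j
        by_cases hj : j ∈ V
        · simp [vertex, hj]
        · simp [vertex, hj, hw'0 j hj]
      have e2 : vertexWeight V A s w' = vertexWeight V A s w :=
        Finset.prod_congr rfl fun c hc => by rw [hw'V c hc]
      rw [e1, e2, mul_comm]
    rw [hint] at ei
    have hS0 : 0 ≤ ∑ c ∈ V, K c * ρ ^ 2 / 2 :=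
      Finset.sum_nonneg fun e _ => by have := hK e; positivity
    rw [hcard] at hpr
    calc _ ≤ |ψ w - ψ (setCoord w a 0)| + (|ψ (setCoord w a 0) - ψ w'| + |ψ w' - _|) := by
          refine (abs_sub_le _ (ψ (setCoord w a 0)) _).trans ?_
          gcongr
          exact abs_sub_le _ _ _
      _ ≤ La * ρ + (Lb * ρ + (49 / 40) ^ (d - 2) * ∑ c ∈ V, K c * ρ ^ 2 / 2) := by
          gcongr
          exact ei.trans (by gcongr)
      _ = _ := by ring

/-- A function with the indicated bounded derivatives is close to the sum of a Taylor polynomial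
and a multilinear polynomial. -/
lemma exists_offdiag_approx {X : Set (E d)} (hX : IsOpen X) {m : ℕ} {g : E d → ℝ}
    (hg : ContDiffOn ℝ (m + 2 : ℕ) g X) {c : E d} {ρ : ℝ} (hρ : 0 < ρ)
    (hball : Metric.closedBall c ρ ⊆ X) {a b : Fin d} (hab : a ≠ b) (hd : 3 ≤ d) {K : Fin d → ℝ}
    (hK : ∀ i, 0 ≤ K i)
    (h2 : ∀ i, i ≠ a → i ≠ b → ∀ l : List (Fin d), l.length = m → ∀ x ∈ Metric.closedBall c ρ,
      |dlist l (dpart i (dpart i g)) x| ≤ K i)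
    (ha : ∀ l : List (Fin d), l.length = m + 1 → ∀ x ∈ Metric.closedBall c ρ,
      |dlist l (dpart a g) x| ≤ K a)
    (hb : ∀ l : List (Fin d), l.length = m + 1 → ∀ x ∈ Metric.closedBall c ρ,
      |dlist l (dpart b g) x| ≤ K b) :
    ∃ P : E d → ℝ, Continuous P ∧ IsLinePoly (max (m + 1) (d - 2)) P ∧
      ∀ x ∈ Metric.closedBall c ρ, |g x - P x| ≤
        (K a * (√d * ρ) ^ (m + 1) / (m + 1).factorial
          + K b * (√d * ρ) ^ (m + 1) / (m + 1).factorial) * ρ +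
        (49 / 40) ^ (d - 2) * (∑ i ∈ (Finset.univ.erase a).erase b,
          K i * (√d * ρ) ^ m / m.factorial * ρ ^ 2 / 2) := by
  have hc : c ∈ X := hball (Metric.mem_closedBall_self hρ.le)
  -- Degree `m + 1` is chosen so that `∂_i φ` and `∂_i² φ` are Taylor remainders of orders `m + 1`
  -- and `m`, matching the derivatives that are assumed bounded.
  set φ : E d → ℝ := fun x => g x - taylorPoly (m + 2) g c x with hφ
  have hT (n : ℕ) (u : E d → ℝ) := taylorPoly_differentiable hX n u hc
  have hg1 (i : Fin d) : ContDiffOn ℝ (m + 1 : ℕ) (dpart i g) X := dpart_contDiffOn hX hg i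
  have hg2 (i : Fin d) : ContDiffOn ℝ m (dpart i (dpart i g)) X := dpart_contDiffOn hX (hg1 i) i
  have dsub (u v : E d → ℝ) (i : Fin d) (x : E d) (hu : DifferentiableAt ℝ u x)
      (hv : DifferentiableAt ℝ v x) :
      dpart i (fun y => u y - v y) x = dpart i u x - dpart i v x := by
    simp only [dpart]; rw [fderiv_fun_sub hu hv]; rfl
  have dg (x : E d) (hx : x ∈ X) : DifferentiableAt ℝ g x :=
    differentiableAt_of_contDiffOn hX (by simp) hg hx
  have dg1 (i : Fin d) (x : E d) (hx : x ∈ X) : DifferentiableAt ℝ (dpart i g) x :=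
    differentiableAt_of_contDiffOn hX (by simp) (hg1 i) hx
  have p1 (i : Fin d) : Set.EqOn (dpart i φ)
      (fun x => dpart i g x - taylorPoly (m + 1) (dpart i g) c x) X := fun x hx => by
    rw [hφ, dsub g _ i x (dg x hx) (hT _ _ x), dpart_taylorPoly hX (hg.of_le (by norm_cast; omega)) hc]
  have p2 (i : Fin d) : Set.EqOn (dpart i (dpart i φ))
      (fun x => dpart i (dpart i g) x - taylorPoly m (dpart i (dpart i g)) c x) X := fun x hx => by
    rw [dpart_congr hX (p1 i) i hx, dsub _ _ i x (dg1 i x hx) (hT _ _ x),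
      dpart_taylorPoly hX ((hg1 i).of_le (by norm_cast; omega)) hc]
  have inball (w : E d) (hw : ‖w‖ ≤ ρ) : c + w ∈ Metric.closedBall c ρ := by
    rw [mem_closedBall_iff_norm]; simpa
  have trans_diff (u : E d → ℝ) (w : E d) (h : DifferentiableAt ℝ u (c + w)) :
      DifferentiableAt ℝ (fun w => u (c + w)) w :=
    DifferentiableAt.comp w (f := fun w => c + w) h (by fun_prop)
  have dp1 (i : Fin d) (x : E d) (hx : x ∈ X) : DifferentiableAt ℝ (dpart i φ) x :=
    ((dg1 i x hx).sub (hT _ _ x)).congr_of_eventuallyEq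
      ((p1 i).eventuallyEq_of_mem (hX.mem_nhds hx))
  obtain ⟨P, hPc, hPl, hP⟩ := exists_multilinear_approx (ψ := fun w => φ (c + w)) hρ hab hd
    (K := fun i => K i * (√d * ρ) ^ m / m.factorial)
    (fun i => by have := hK i; positivity)
    (La := K a * (√d * ρ) ^ (m + 1) / (m + 1).factorial)
    (Lb := K b * (√d * ρ) ^ (m + 1) / (m + 1).factorial)
    (fun w hw => trans_diff _ _ ((dg _ (hball (inball w hw))).sub (hT _ _ _)))
    (fun i _ _ w hw => by
      rw [dpart_comp_add]
      exact trans_diff _ _ (dp1 i _ (hball (inball w hw))))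
    (fun i hia hib w hw => by
      rw [dpart_comp_add, dpart_comp_add]
      beta_reduce
      rw [p2 i (hball (inball w hw))]
      exact abs_sub_taylorPoly_le hX (hg2 i) hball (hK i) (h2 i hia hib) (inball w hw))
    (fun w hw => by
      rw [dpart_comp_add]
      beta_reduce
      rw [p1 a (hball (inball w hw))]
      exact abs_sub_taylorPoly_le hX (hg1 a) hball (hK a) ha (inball w hw))
    (fun w hw => by
      rw [dpart_comp_add]
      beta_reduce
      rw [p1 b (hball (inball w hw))]
      exact abs_sub_taylorPoly_le hX (hg1 b) hball (hK b) hb (inball w hw))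
  refine ⟨fun x => taylorPoly (m + 2) g c x + P (x - c), ?_, ?_, ?_⟩
  · exact (hT _ _).continuous.add (hPc.comp (by fun_prop))
  · exact ((isLinePoly_taylorPoly (m + 2) g c).mono (by simp)).add
      ((hPl.comp_sub c).mono (le_max_right _ _))
  · intro x hx
    have := hP (x - c) (mem_closedBall_iff_norm.1 hx)
    simp only [add_sub_cancel, hφ] at this
    rwa [sub_sub] at this

/-! ### Iterated forward differences and their mean value theorem. -/

/-- Iterated forward differences with step `t`. -/
def fdiff {V : Type*} [AddCommGroup V] : List (Fin d) → ℝ → (E d → V) → E d → V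
  | [], _, G => G
  | i :: l, t, G => fdiff l t (fun y => G (y + t • EuclideanSpace.single i 1) - G y)

lemma fdiff_map {V W : Type*} [AddCommGroup V] [Module ℝ V] [AddCommGroup W] [Module ℝ W]
    (φ : V →ₗ[ℝ] W) (l : List (Fin d)) (t : ℝ) (G : E d → V) (x : E d) :
    φ (fdiff l t G x) = fdiff l t (fun y => φ (G y)) x := by
  induction l generalizing G with
  | nil => rfl
  | cons i l ih => simp only [fdiff, ih, map_sub]

lemma norm_step (t : ℝ) (ht : 0 < t) (i : Fin d) :
    ‖t • (EuclideanSpace.single i 1 : E d)‖ = t := by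
  simp [norm_smul, abs_of_pos ht]

lemma add_step_mem_ball {x y : E d} {t R : ℝ} (ht : 0 < t) (i : Fin d)
    (hy : y ∈ Metric.ball x (R - t)) : y + t • EuclideanSpace.single i 1 ∈ Metric.ball x R := by
  rw [mem_ball_iff_norm] at hy ⊢
  calc _ = ‖(y - x) + t • (EuclideanSpace.single i 1 : E d)‖ := by congr 1; abel
    _ ≤ ‖y - x‖ + t := (norm_add_le _ _).trans_eq (by rw [norm_step t ht])
    _ < R := by linarith

lemma fdiff_induction {V : Type*} [AddCommGroup V] (p : V → Prop)
    (hp : ∀ u v, p u → p v → p (u - v)) (l : List (Fin d)) {t R : ℝ} (ht : 0 < t) {x : E d}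
    (hR : l.length * t < R) {G : E d → V} (hG : ∀ y ∈ Metric.ball x R, p (G y)) :
    p (fdiff l t G x) := by
  induction l generalizing G R with
  | nil => exact hG x (Metric.mem_ball_self (by simpa using hR))
  | cons i l ih =>
    simp only [List.length_cons, Nat.cast_add, Nat.cast_one] at hR
    refine ih (R := R - t) (by linarith) fun y hy => ?_
    exact hp _ _ (hG _ (add_step_mem_ball ht i hy))
      (hG _ (Metric.ball_subset_ball (by linarith) hy))

lemma fdiff_congr {V : Type*} [AddCommGroup V] (l : List (Fin d)) {t R : ℝ} (ht : 0 < t) {x : E d}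
    (hR : l.length * t < R) {G G' : E d → V} (hG : Set.EqOn G G' (Metric.ball x R)) :
    fdiff l t G x = fdiff l t G' x := by
  induction l generalizing G G' R with
  | nil => exact hG (Metric.mem_ball_self (by simpa using hR))
  | cons i l ih =>
    simp only [List.length_cons, Nat.cast_add, Nat.cast_one] at hR
    refine ih (R := R - t) (by linarith) fun y hy => ?_
    simp only [hG (add_step_mem_ball ht i hy), hG (Metric.ball_subset_ball (by linarith) hy)]

lemma dlist_sub {X : Set (E d)} (hX : IsOpen X) (l : List (Fin d)) {u v : E d → ℝ}
    (hu : ContDiffOn ℝ (l.length : ℕ) u X) (hv : ContDiffOn ℝ (l.length : ℕ) v X) {x : E d}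
    (hx : x ∈ X) : dlist l (u - v) x = dlist l u x - dlist l v x := by
  induction l generalizing u v with
  | nil => rfl
  | cons i l ih =>
    have : Set.EqOn (dpart i (u - v)) (dpart i u - dpart i v) X := fun y hy => by
      simp only [dpart, Pi.sub_apply]
      rw [fderiv_sub (differentiableAt_of_contDiffOn hX (by simp) hu hy)
        (differentiableAt_of_contDiffOn hX (by simp) hv hy)]
      rfl
    simp only [dlist_cons]
    rw [dlist_congr hX l this hx, ih (dpart_contDiffOn hX hu i) (dpart_contDiffOn hX hv i)]

lemma dlist_comp_add_right (v : E d) (l : List (Fin d)) (g : E d → ℝ) :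
    dlist l (fun y => g (y + v)) = fun y => dlist l g (y + v) := by
  induction l generalizing g with
  | nil => rfl
  | cons i l ih =>
    have : dpart i (fun y => g (y + v)) = fun y => dpart i g (y + v) := by
      funext w; simp only [dpart]; rw [fderiv_comp_add_right]
    simp only [dlist_cons, this, ih]

lemma dpart_dlist {X : Set (E d)} (hX : IsOpen X) (i : Fin d) (l : List (Fin d)) {g : E d → ℝ}
    (hg : ContDiffOn ℝ (l.length + 1 : ℕ) g X) :
    Set.EqOn (dpart i (dlist l g)) (dlist (i :: l) g) X := by
  have h := dlist_perm hX (l := i :: l) (l' := l ++ [i]) (List.perm_append_singleton i l).symm hg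
  rw [dlist_append] at h
  exact h.symm

/-- The mean value theorem for iterated differences. -/
lemma exists_fdiff_eq (l : List (Fin d)) {t R : ℝ} (ht : 0 < t) {x : E d} (hR : l.length * t < R)
    {g : E d → ℝ} (hg : ContDiffOn ℝ (l.length : ℕ) g (Metric.ball x R)) :
    ∃ ξ ∈ Metric.ball x R, fdiff l t g x = t ^ l.length * dlist l g ξ := by
  induction l generalizing g R with
  | nil => exact ⟨x, Metric.mem_ball_self (by simpa using hR), by simp [fdiff]⟩
  | cons i l ih =>
    simp only [List.length_cons, Nat.cast_add, Nat.cast_one] at hR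
    set v : E d := t • EuclideanSpace.single i 1 with hv
    have hsub : Metric.ball x (R - t) ⊆ Metric.ball x R := Metric.ball_subset_ball (by linarith)
    have hgl : ContDiffOn ℝ (l.length : ℕ) g (Metric.ball x R) := hg.of_le (by simp)
    have hshift : ContDiffOn ℝ (l.length : ℕ) (fun y => g (y + v)) (Metric.ball x (R - t)) :=
      hgl.comp (f := fun y => y + v) (by fun_prop) fun y hy => add_step_mem_ball ht i hy
    obtain ⟨η, hη, he⟩ := ih (R := R - t) (by linarith) (g := (fun y => g (y + v)) - g)
      (hshift.sub (hgl.mono hsub))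
    rw [dlist_sub Metric.isOpen_ball l hshift (hgl.mono hsub) hη, dlist_comp_add_right] at he
    have hseg : ∀ s ∈ Set.Icc (0 : ℝ) t, η + s • EuclideanSpace.single i 1 ∈ Metric.ball x R := by
      intro s hs
      rcases eq_or_lt_of_le hs.1 with h0 | h0
      · rw [← h0]; simpa using Metric.mem_ball.1 (hsub hη)
      · exact add_step_mem_ball h0 i (Metric.ball_subset_ball (by linarith [hs.2]) hη)
    have hder : ∀ s ∈ Set.Icc (0 : ℝ) t, HasDerivAt
        (fun s : ℝ => dlist l g (η + s • EuclideanSpace.single i 1))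
        (dlist (i :: l) g (η + s • EuclideanSpace.single i 1)) s := by
      intro s hs
      have h1 : HasDerivAt (fun s : ℝ => η + s • (EuclideanSpace.single i 1 : E d))
          (EuclideanSpace.single i 1) s := by
        simpa using ((hasDerivAt_id s).smul_const (EuclideanSpace.single i 1 : E d)).const_add η
      have h2 : DifferentiableAt ℝ (dlist l g) (η + s • EuclideanSpace.single i 1) :=
        differentiableAt_of_contDiffOn Metric.isOpen_ball one_ne_zero
          (dlist_contDiffOn Metric.isOpen_ball l (by rw [add_comm]; exact hg)) (hseg s hs)
      have h3 := h2.hasFDerivAt.comp_hasDerivAt s h1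
      have h4 := dpart_dlist Metric.isOpen_ball i l hg (hseg s hs)
      rw [← h4]
      exact h3
    obtain ⟨s, hs, hs'⟩ := exists_hasDerivAt_eq_slope
      (fun s : ℝ => dlist l g (η + s • EuclideanSpace.single i 1)) _ ht
      (fun s hs => (hder s hs).continuousAt.continuousWithinAt)
      (fun s hs => hder s ⟨hs.1.le, hs.2.le⟩)
    refine ⟨_, hseg s ⟨hs.1.le, hs.2.le⟩, ?_⟩
    rw [hs']
    have : fdiff (i :: l) t g x = fdiff l t ((fun y => g (y + v)) - g) x := rfl
    rw [this, he]
    simp only [zero_smul, add_zero, sub_zero, List.length_cons, ← hv]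
    field_simp
    ring

/-! ### The kernel model: derivative bounds in the space and the nonnegative function `b`. -/

open scoped MatrixOrder Matrix.Norms.L2Operator in
lemma exists_eq_transpose_mul_self {ι : Type*} [Fintype ι] [DecidableEq ι] {B : Matrix ι ι ℝ}
    (hB : B.PosSemidef) : ∃ A : Matrix ι ι ℝ, B = Aᵀ * A := by
  obtain ⟨A, hA⟩ := CStarAlgebra.nonneg_iff_eq_star_mul_self.mp hB.nonneg
  exact ⟨A, by rw [hA, Matrix.star_eq_conjTranspose, Matrix.conjTranspose_eq_transpose_of_trivial]⟩

section kernel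

variable {X : Set (E d)} {H : Type*} [NormedAddCommGroup H] [InnerProductSpace ℝ H]
  [CompleteSpace H] [RKHS ℝ H X ℝ] {k : E d → E d → ℝ}

/-- The kernel sections, extended by zero outside `X`. -/
def kerSection (X : Set (E d)) (H : Type*) [NormedAddCommGroup H] [InnerProductSpace ℝ H]
    [CompleteSpace H] [RKHS ℝ H X ℝ] (y : E d) : H :=
  open Classical in if h : y ∈ X then RKHS.kerFun H (⟨y, h⟩ : X) (1 : ℝ) else 0

lemma inner_kerSection {y : E d} (hy : y ∈ X) (u : H) :
    inner ℝ (kerSection X H y) u = u ⟨y, hy⟩ := by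
  rw [kerSection, dif_pos hy, RKHS.kerFun_inner]
  simp

lemma inner_kerSection_kerSection (hk : ∀ x y : X, RKHS.kernel H x y (1 : ℝ) = k x y) {x y : E d}
    (hx : x ∈ X) (hy : y ∈ X) : inner ℝ (kerSection X H y) (kerSection X H x) = k x y := by
  have := RKHS.kernel_inner H (⟨x, hx⟩ : X) ⟨y, hy⟩ (1 : ℝ) 1
  rw [kerSection, dif_pos hy, kerSection, dif_pos hx, ← this, hk]
  simp

/-- The mean value theorem for differences is used once in each variable, giving `t^m t^m` times a
mixed derivative of `k` at a pair of possibly distinct points; hence the need for a bound off the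
diagonal too. -/
lemma abs_fdiff_fdiff_kernel_le (hX : IsOpen X) {m : ℕ} {D : ℝ} (hder : KernelDerivBounded k X m D)
    (l : List (Fin d)) (hl : l.length = m) {x : E d} {t R : ℝ} (ht : 0 < t) (hR : m * t < R)
    (hball : Metric.ball x R ⊆ X) :
    |fdiff l t (fun y => fdiff l t (fun x' => k x' y) x) x| ≤ (t ^ m * D) ^ 2 := by
  subst hl
  obtain ⟨σ, hσ⟩ := exists_reverse_ofFn_eq l rfl
  have heval (y : E d) : fdiff l t (fun x' => k x' y) x = fdiff l t k x y :=
    (fdiff_map (LinearMap.proj (R := ℝ) (φ := fun _ : E d => ℝ) y) l t k x).symm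
  simp only [heval]
  -- Carrying the pair (function, its derivative at `η`) through the differences shows at once that
  -- the difference is smooth and that differentiation in `y` commutes with differencing in `x`.
  have hpair (η : E d) (hη : η ∈ X) := fdiff_induction (V := (E d → ℝ) × ℝ)
    (fun p => ContDiffOn ℝ (l.length : ℕ) p.1 X ∧ dlist l p.1 η = p.2)
    (fun p q hp hq => ⟨hp.1.sub hq.1, by
      change dlist l (p.1 - q.1) η = _
      rw [dlist_sub hX l hp.1 hq.1 hη, hp.2, hq.2]; rfl⟩)
    l ht hR (G := fun x' => (k x', dlist l (k x') η))
    (fun y hy => ⟨hder.1.contDiff_right y (hball hy), rfl⟩)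
  have hfst (η : E d) : (fdiff l t (fun x' => (k x', dlist l (k x') η)) x).1 = fdiff l t k x :=
    fdiff_map (LinearMap.fst ℝ (E d → ℝ) ℝ) l t _ x
  have hsnd (η : E d) : (fdiff l t (fun x' => (k x', dlist l (k x') η)) x).2
      = fdiff l t (fun x' => dlist l (k x') η) x :=
    fdiff_map (LinearMap.snd ℝ (E d → ℝ) ℝ) l t _ x
  simp only [hfst, hsnd] at hpair
  have hxX : x ∈ X := hball (Metric.mem_ball_self (lt_of_le_of_lt (by positivity) hR))
  obtain ⟨η, hη, e1⟩ := exists_fdiff_eq l ht hR ((hpair x hxX).1.mono hball)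
  have hηX := hball hη
  have heq : Set.EqOn (fun x' => pderiv σ (k x') η) (fun x' => dlist l (k x') η) X :=
    fun x' hx' => by
      have := pderiv_eq_dlist hX (hder.1.contDiff_right x' hx') σ hηX
      rwa [hσ] at this
  have hsm := hder.1.contDiff_left l.length le_rfl σ η hηX
  obtain ⟨ξ, hξ, e2⟩ := exists_fdiff_eq l ht hR
    ((hsm.congr fun x' hx' => (heq hx').symm).mono hball)
  rw [e1, (hpair η hηX).2, e2, ← dlist_congr hX l heq (hball hξ)]
  have hb := hder.2 σ ξ (hball hξ) η hηX
  rw [mixedDeriv, pderiv_eq_dlist hX hsm σ (hball hξ), hσ] at hb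
  rw [abs_mul, abs_mul, abs_of_pos (by positivity : 0 < t ^ l.length)]
  calc _ ≤ t ^ l.length * (t ^ l.length * D ^ 2) := by gcongr
    _ = _ := by ring

/-- Derivatives of order `m` of elements of the space are bounded by `D` times the norm. -/
lemma abs_dlist_le_of_mem (hX : IsOpen X) (hk : ∀ x y : X, RKHS.kernel H x y (1 : ℝ) = k x y)
    {m : ℕ} {D : ℝ} (hD : 0 ≤ D) (hder : KernelDerivBounded k X m D) (u : H) {u' : E d → ℝ}
    (hu : ∀ x : X, u x = u' x) (hu' : ContDiffOn ℝ m u' X) (l : List (Fin d)) (hl : l.length = m)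
    {x : E d} (hx : x ∈ X) : |dlist l u' x| ≤ D * ‖u‖ := by
  obtain ⟨R₀, hR₀, hball₀⟩ := Metric.isOpen_iff.1 hX x hx
  have key : ∀ R, 0 < R → R ≤ R₀ → ∃ ξ ∈ Metric.ball x R, |dlist l u' ξ| ≤ D * ‖u‖ := by
    intro R hR hRR
    have hball : Metric.ball x R ⊆ X := (Metric.ball_subset_ball hRR).trans hball₀
    -- With this step, all `m` successive shifts stay inside the ball of radius `R`.
    set t := R / (m + 1) with htdef
    have ht : 0 < t := by positivity
    have hmt : m * t < R := by
      rw [htdef, mul_div_assoc', div_lt_iff₀ (by positivity)]; nlinarith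
    have hmt' : l.length * t < R := by rwa [hl]
    -- Pairing with `w` gives the difference of `u'`, while `‖w‖ ≤ t^m D`. The factor `t^m` cancels
    -- after Cauchy-Schwarz, so no derivative of a kernel section in `H` is needed.
    set w : H := fdiff l t (kerSection X H) x with hw
    have hin (v : H) : inner ℝ v w = fdiff l t (fun y => inner ℝ v (kerSection X H y)) x :=
      fdiff_map (innerSL ℝ v).toLinearMap l t _ x
    have hwu : inner ℝ u w = fdiff l t u' x := by
      rw [hin]
      refine fdiff_congr l ht hmt' fun y hy => ?_
      rw [real_inner_comm, inner_kerSection (hball hy), hu]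
    have hww : inner ℝ w w = fdiff l t (fun y => fdiff l t (fun x' => k x' y) x) x := by
      rw [hin]
      refine fdiff_congr l ht hmt' fun y hy => ?_
      rw [real_inner_comm, hin]
      refine fdiff_congr l ht hmt' fun x' hx' => ?_
      exact inner_kerSection_kerSection hk (hball hx') (hball hy)
    have hwn : ‖w‖ ≤ t ^ m * D := by
      refine le_of_sq_le_sq ?_ (by positivity)
      rw [← real_inner_self_eq_norm_sq, hww]
      exact (le_abs_self _).trans (abs_fdiff_fdiff_kernel_le hX hder l hl ht hmt hball)
    obtain ⟨ξ, hξ, e⟩ := exists_fdiff_eq l ht hmt' (g := u') (by rw [hl]; exact hu'.mono hball)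
    refine ⟨ξ, hξ, ?_⟩
    rw [← hwu, hl] at e
    have h1 := abs_real_inner_le_norm u w
    rw [e, abs_mul, abs_of_pos (by positivity : 0 < t ^ m)] at h1
    have h2 : t ^ m * |dlist l u' ξ| ≤ t ^ m * (D * ‖u‖) := by
      nlinarith [norm_nonneg u]
    exact le_of_mul_le_mul_left h2 (by positivity)
  -- The bound holds at points arbitrarily close to `x`; continuity transfers it to `x`.
  have hcont : ContinuousAt (dlist l u') x :=
    (dlist_contDiffOn hX l (n := 0) (by rw [hl, zero_add]; exact hu')).continuousOn.continuousAt
      (hX.mem_nhds hx)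
  by_contra hlt
  push Not at hlt
  obtain ⟨R, hR, hRb⟩ := Metric.eventually_nhds_iff_ball.1 (hcont.abs.eventually (lt_mem_nhds hlt))
  obtain ⟨ξ, hξ, hle⟩ := key (min R R₀) (lt_min hR hR₀) (min_le_right _ _)
  exact absurd (hRb ξ (Metric.ball_subset_ball (min_le_left _ _) hξ)) (not_lt.2 hle)

variable {n : ℕ} {xs : Fin n → E d} {R : Matrix (Fin n) (Fin n) ℝ}

/-- As `RᵀR` is the Gram matrix of the kernel sections at the nodes, these sections and the columns
of `R` span isometric spaces. The function `u` corresponds to the orthogonal projection of `c` onto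
the column span: projection preserves inner products with columns and does not increase the norm.
The kernel matrix may be singular. -/
lemma exists_feature (hk : ∀ x y : X, RKHS.kernel H x y (1 : ℝ) = k x y)
    {m : ℕ} {D : ℝ} (hder : KernelDerivBounded k X m D) (hxs : ∀ i, xs i ∈ X)
    (hR : IsUpperFactor R k xs) (c : Fin n → ℝ) :
    ∃ (u : H) (u' : E d → ℝ), ContDiffOn ℝ m u' X ∧ (∀ x : X, u x = u' x) ∧
      (∀ j, u' (xs j) = ∑ p, c p * R p j) ∧ ‖u‖ ^ 2 ≤ ∑ p, c p ^ 2 := by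
  set col : Fin n → EuclideanSpace ℝ (Fin n) := fun j => WithLp.toLp 2 fun p => R p j with hcol
  have hgram (i j : Fin n) : inner ℝ (col i) (col j) = k (xs j) (xs i) := by
    have := congrFun (congrFun hR.2 j) i
    rw [Matrix.mul_apply] at this
    simp only [Matrix.transpose_apply, Matrix.of_apply] at this
    rw [← this]
    simp [hcol, PiLp.inner_apply]
  set U := Submodule.span ℝ (Set.range col) with hU
  set c' : EuclideanSpace ℝ (Fin n) := WithLp.toLp 2 c with hc'
  obtain ⟨α, hα⟩ := (Submodule.mem_span_range_iff_exists_fun ℝ).1 (U.starProjection_apply_mem c')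
  have hsym {x y : E d} (hx : x ∈ X) (hy : y ∈ X) : k x y = k y x := by
    rw [← inner_kerSection_kerSection hk hx hy, real_inner_comm,
      inner_kerSection_kerSection hk hy hx]
  have hval {y : E d} (hy : y ∈ X) :
      (∑ j, α j • kerSection X H (xs j) : H) ⟨y, hy⟩ = ∑ j, α j * k (xs j) y := by
    rw [← inner_kerSection hy, inner_sum]
    refine Finset.sum_congr rfl fun j _ => ?_
    rw [inner_smul_right, inner_kerSection_kerSection hk (hxs j) hy]
  refine ⟨∑ j, α j • kerSection X H (xs j), fun y => ∑ j, α j * k (xs j) y, ?_, ?_, ?_, ?_⟩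
  · exact ContDiffOn.sum fun j _ => contDiffOn_const.mul (hder.1.contDiff_right _ (hxs j))
  · exact fun x => hval x.2
  · intro j
    have h1 : inner ℝ (U.starProjection c') (col j) = inner ℝ c' (col j) := by
      have hmem : col j ∈ U := Submodule.subset_span ⟨j, rfl⟩
      have h := Submodule.inner_starProjection_left_eq_right U c' (col j)
      rw [h, Submodule.starProjection_eq_self_iff.2 hmem]
    rw [← hα, sum_inner] at h1
    simp only [inner_smul_left, hgram] at h1
    simp only [RCLike.conj_to_real] at h1
    calc ∑ i, α i * k (xs i) (xs j) = ∑ i, α i * k (xs j) (xs i) :=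
          Finset.sum_congr rfl fun i _ => by rw [hsym (hxs i) (hxs j)]
      _ = _ := by rw [h1]; simp [hc', hcol, PiLp.inner_apply, mul_comm]
  · have h1 : ‖(∑ j, α j • kerSection X H (xs j) : H)‖ ^ 2 = ‖U.starProjection c'‖ ^ 2 := by
      rw [← real_inner_self_eq_norm_sq, ← real_inner_self_eq_norm_sq, ← hα, sum_inner, sum_inner]
      refine Finset.sum_congr rfl fun i _ => ?_
      rw [inner_sum, inner_sum]
      refine Finset.sum_congr rfl fun j _ => ?_
      rw [inner_smul_left, inner_smul_left, inner_smul_right, inner_smul_right, hgram,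
        inner_kerSection_kerSection hk (hxs j) (hxs i)]
    rw [h1]
    have h2 : ‖U.starProjection c'‖ ≤ ‖c'‖ := U.norm_starProjection_apply_le c'
    calc _ ≤ ‖c'‖ ^ 2 := by gcongr
      _ = _ := by rw [EuclideanSpace.norm_sq_eq]; simp [hc']

/-- The quadratic form of the kernel model, along a unit vector. -/
lemma exists_model (hX : IsOpen X) (hk : ∀ x y : X, RKHS.kernel H x y (1 : ℝ) = k x y)
    {M : ℝ} (hM : 0 ≤ M) (hprod : ProductBounded (X := X) H M)
    {m : ℕ} {D : ℝ} (hD : 0 ≤ D) (hder : KernelDerivBounded k X m D) (hxs : ∀ i, xs i ∈ X)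
    (hR : IsUpperFactor R k xs) {B : Matrix (Fin n × Fin d) (Fin n × Fin d) ℝ}
    (hB : B.PosSemidef) {v : Fin d → ℝ} (hv : ∑ i, v i ^ 2 ≤ 1) :
    ∃ b : E d → ℝ, ContDiffOn ℝ m b X ∧ (∀ x ∈ X, 0 ≤ b x) ∧
      (∀ j, b (xs j) = v ⬝ᵥ (((Psi d R j).transpose * B * Psi d R j) *ᵥ v)) ∧
      ∀ l : List (Fin d), l.length = m → ∀ x ∈ X, |dlist l b x| ≤ M * D * B.trace := by
  obtain ⟨A, rfl⟩ := exists_eq_transpose_mul_self hB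
  -- Row `q` of `A` contracted with `v` in the `Fin d` factor, so that the feature of `c q` equals
  -- `(A Ψ_j v) q` at `x_j`.
  set c : Fin n × Fin d → Fin n → ℝ := fun q p => ∑ a, A q (p, a) * v a with hc
  choose u u' hu'C hu hu'xs hun using fun q => exists_feature (H := H) hk hder hxs hR (c q)
  choose w hw hwn using fun q => hprod (u q) (u q)
  have hbC : ContDiffOn ℝ m (fun x => ∑ q, u' q x ^ 2) X :=
    ContDiffOn.sum fun q _ => (hu'C q).pow 2
  refine ⟨fun x => ∑ q, u' q x ^ 2, hbC, fun x _ => Finset.sum_nonneg fun q _ => sq_nonneg _, ?_, ?_⟩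
  · intro j
    have hΨ : ∀ q, u' q (xs j) = (A *ᵥ (Psi d R j *ᵥ v)) q := by
      intro q
      rw [hu'xs, Matrix.mulVec, dotProduct, Fintype.sum_prod_type]
      refine Finset.sum_congr rfl fun p _ => ?_
      rw [hc, Finset.sum_mul]
      refine Finset.sum_congr rfl fun a _ => ?_
      have : (Psi d R j *ᵥ v) (p, a) = R p j * v a := by
        simp [Psi, Matrix.mulVec, dotProduct, Matrix.one_apply]
      rw [this]; ring
    simp only [hΨ]
    have : (Psi d R j)ᵀ * (Aᵀ * A) * Psi d R j = (A * Psi d R j)ᵀ * (A * Psi d R j) := by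
      rw [Matrix.transpose_mul]; simp only [Matrix.mul_assoc]
    rw [this, ← Matrix.mulVec_mulVec, Matrix.dotProduct_mulVec, Matrix.vecMul_transpose,
      Matrix.mulVec_mulVec]
    simp [dotProduct, sq]
  · intro l hl x hx
    have hrep : ∀ x : X, (∑ q, w q : H) x = (fun x => ∑ q, u' q x ^ 2) (x : E d) := by
      intro x
      rw [← inner_kerSection x.2, inner_sum]
      refine Finset.sum_congr rfl fun q _ => ?_
      rw [inner_kerSection x.2, hw, hu, sq]
    refine (abs_dlist_le_of_mem hX hk hD hder _ hrep hbC l hl hx).trans ?_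
    have hnorm : ‖(∑ q, w q : H)‖ ≤ M * (Aᵀ * A).trace := by
      refine (norm_sum_le _ _).trans ?_
      have htr : (Aᵀ * A).trace = ∑ q, ∑ p, ∑ a, A q (p, a) ^ 2 := by
        rw [Matrix.trace, Fintype.sum_congr _ (fun r => ∑ q, A q r ^ 2) (fun r => by
          simp [Matrix.mul_apply, sq]), Finset.sum_comm]
        exact Finset.sum_congr rfl fun q _ => Fintype.sum_prod_type _
      rw [htr, Finset.mul_sum]
      refine Finset.sum_le_sum fun q _ => (hwn q).trans ?_
      rw [mul_assoc, ← sq]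
      refine mul_le_mul_of_nonneg_left ((hun q).trans (Finset.sum_le_sum fun p _ => ?_)) hM
      refine (Finset.sum_mul_sq_le_sq_mul_sq _ _ _).trans ?_
      exact mul_le_of_le_one_right (Finset.sum_nonneg fun _ _ => sq_nonneg _) hv
    calc D * ‖(∑ q, w q : H)‖ ≤ D * (M * (Aᵀ * A).trace) := by gcongr
      _ = _ := by ring

end kernel

/-! ### Numerical inequalities behind `constC0`. -/

/-- For the case `m ≥ 6` with `κ = 9/10`: here `11 = 1 + 1/(1 - κ)`, `14/5 ≤ √8 ≤ √d`, and `2m - 3`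
is the largest possible value of `d - 2`. -/
lemma pow_bound_one {m : ℕ} (hm : 6 ≤ m) :
    11 * (1 + (49 / 40 : ℝ) ^ (2 * m - 3) * (m * (m - 1)) / 2) ≤ 3 * (14 / 5) ^ m := by
  induction m, hm using Nat.le_induction with
  | base => norm_num
  | succ m hm ih =>
    have h6 : (6 : ℝ) ≤ m := by exact_mod_cast hm
    have e : 2 * (m + 1) - 3 = 2 + (2 * m - 3) := by omega
    rw [e, pow_add, pow_succ (14 / 5 : ℝ) m]
    push_cast
    set Λ := (49 / 40 : ℝ) ^ (2 * m - 3)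
    have hΛ : 0 < Λ := by positivity
    have h1 : (m + 1 : ℝ) * (m + 1 - 1) * (49 / 40) ^ 2 ≤ 14 / 5 * (m * (m - 1)) := by nlinarith
    have h2 := mul_le_mul_of_nonneg_left h1 hΛ.le
    linarith

lemma pow_bound_two {m : ℕ} (hm : 6 ≤ m) : 11 * (1 + m : ℝ) ≤ 3 * (14 / 5) ^ (m - 1) := by
  induction m, hm using Nat.le_induction with
  | base => norm_num
  | succ m hm ih =>
    have h6 : (6 : ℝ) ≤ m := by exact_mod_cast hm
    obtain ⟨j, rfl⟩ : ∃ j, m = j + 1 := ⟨m - 1, by omega⟩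
    simp only [Nat.add_sub_cancel] at ih ⊢
    rw [pow_succ]
    push_cast at ih h6 ⊢
    linarith

/-- The factor lost in the approximation by polynomials when `m + 2 ≤ d`. -/
def lossFactor (d m : ℕ) : ℝ :=
  1 + max (m * √d) ((49 / 40) ^ (d - 2) * (m * (m - 1)) / 2)

/-- The first two inequalities are those of `norming` for degree `d - 2` and radius `17 (m-1)² h`,
divided by `h`; the third fits the loss into `3 √d ^ m`. The hypotheses force `m ≥ 3`. A larger `κ`
eases norming but worsens the loss, so small `m` need individual values. -/
lemma exists_norming_constant {d m : ℕ} (h1 : m + 2 ≤ d) (h2 : d + 1 ≤ 2 * m) :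
    ∃ κ : ℝ, κ < 1 ∧ 6 * ((d - 2 : ℕ) : ℝ) ^ 2 ≤ κ * (8 / 5 * (17 * ((m : ℝ) - 1) ^ 2) - 3) ∧
      2 * ((d - 2 : ℕ) : ℝ) ^ 2 ≤ κ * (3 / 5 * (17 * ((m : ℝ) - 1) ^ 2) - 1) ∧
      (1 + 1 / (1 - κ)) * lossFactor d m ≤ 3 * √d ^ m := by
  have hm3 : 3 ≤ m := by omega
  have sq (a : ℝ) (ha : 0 ≤ a) (h : a ^ 2 ≤ d) : a ≤ √d := Real.le_sqrt_of_sq_le h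
  have sq' (a : ℝ) (ha : 0 ≤ a) (h : (d : ℝ) ≤ a ^ 2) : √d ≤ a := Real.sqrt_le_iff.2 ⟨ha, h⟩
  have hsq : √(d : ℝ) ^ 2 = d := Real.sq_sqrt (Nat.cast_nonneg d)
  have big (a : ℝ) (c : ℝ) (ha : m * √d ≤ a) (hb : (49 / 40) ^ (d - 2) * (m * (m - 1)) / 2 ≤ a)
      (hc : 0 ≤ c) : c * lossFactor d m ≤ c * (1 + a) :=
    mul_le_mul_of_nonneg_left (by unfold lossFactor; linarith [max_le ha hb]) hc
  rcases (by omega : m = 3 ∨ m = 4 ∨ m = 5 ∨ 6 ≤ m) with rfl | rfl | rfl | hm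
  · obtain rfl : d = 5 := by omega
    refine ⟨13 / 25, by norm_num, by norm_num, by norm_num, ?_⟩
    have l := sq (223 / 100) (by norm_num) (by norm_num)
    have u := sq' (224 / 100) (by norm_num) (by norm_num)
    refine (big (672 / 100) _ (by push_cast; linarith) (by norm_num) (by norm_num)).trans ?_
    rw [pow_succ, hsq]
    push_cast at *
    linarith
  · have hd6 : (6 : ℝ) ≤ d := by exact_mod_cast (by omega : 6 ≤ d)
    refine ⟨63 / 100, by norm_num, ?_, ?_, ?_⟩
    · have : ((d - 2 : ℕ) : ℝ) ≤ 5 := by exact_mod_cast (by omega)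
      push_cast
      nlinarith [Nat.cast_nonneg (α := ℝ) (d - 2)]
    · have : ((d - 2 : ℕ) : ℝ) ≤ 5 := by exact_mod_cast (by omega)
      push_cast
      nlinarith [Nat.cast_nonneg (α := ℝ) (d - 2)]
    have u := sq' (265 / 100) (by norm_num)
      (by have : (d : ℝ) ≤ 7 := by exact_mod_cast (by omega)
          linarith)
    have hp : (49 / 40 : ℝ) ^ (d - 2) ≤ (49 / 40) ^ 5 :=
      pow_le_pow_right₀ (by norm_num) (by omega)
    refine (big 17 _ (by push_cast; linarith) (by norm_num at hp ⊢; linarith) (by norm_num)).trans ?_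
    rw [show 4 = 2 * 2 from rfl, pow_mul, hsq]
    nlinarith
  · have hd7 : (7 : ℝ) ≤ d := by exact_mod_cast (by omega : 7 ≤ d)
    have l := sq (26 / 10) (by norm_num) (by linarith)
    refine ⟨69 / 100, by norm_num, ?_, ?_, ?_⟩
    · have : ((d - 2 : ℕ) : ℝ) ≤ 7 := by exact_mod_cast (by omega)
      push_cast
      nlinarith [Nat.cast_nonneg (α := ℝ) (d - 2)]
    · have : ((d - 2 : ℕ) : ℝ) ≤ 7 := by exact_mod_cast (by omega)
      push_cast
      nlinarith [Nat.cast_nonneg (α := ℝ) (d - 2)]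
    have u := sq' 3 (by norm_num)
      (by have : (d : ℝ) ≤ 9 := by exact_mod_cast (by omega)
          linarith)
    have hp : (49 / 40 : ℝ) ^ (d - 2) ≤ (49 / 40) ^ 7 :=
      pow_le_pow_right₀ (by norm_num) (by omega)
    refine (big 42 _ (by push_cast; linarith) (by norm_num at hp ⊢; linarith) (by norm_num)).trans ?_
    have : (26 / 10 : ℝ) ^ 5 ≤ √d ^ 5 := by gcongr
    norm_num at this ⊢
    linarith
  · have hm6 : (6 : ℝ) ≤ m := by exact_mod_cast hm
    have hd8 : (8 : ℝ) ≤ d := by exact_mod_cast (by omega : 8 ≤ d)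
    have l := sq (14 / 5) (by norm_num) (by linarith)
    have hN : ((d - 2 : ℕ) : ℝ) ≤ 2 * (m - 1) - 1 := by
      have : ((d - 2 : ℕ) : ℝ) + 3 ≤ 2 * m := by exact_mod_cast (by omega : d - 2 + 3 ≤ 2 * m)
      linarith
    have hN2 : ((d - 2 : ℕ) : ℝ) ^ 2 ≤ (2 * (m - 1) - 1) ^ 2 := by gcongr
    refine ⟨9 / 10, by norm_num, by nlinarith, by nlinarith, ?_⟩
    have e : (1 + 1 / (1 - 9 / 10) : ℝ) = 11 := by norm_num
    rw [e, lossFactor]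
    rcases le_total ((m : ℝ) * √d) ((49 / 40) ^ (d - 2) * (m * (m - 1)) / 2) with h | h
    · rw [max_eq_right h]
      have hp : (49 / 40 : ℝ) ^ (d - 2) ≤ (49 / 40) ^ (2 * m - 3) :=
        pow_le_pow_right₀ (by norm_num) (by omega)
      have h5 := mul_le_mul_of_nonneg_right hp
        (show (0 : ℝ) ≤ m * (m - 1) from mul_nonneg (by linarith) (by linarith))
      have h6 : (14 / 5 : ℝ) ^ m ≤ √d ^ m := by gcongr
      linarith [pow_bound_one hm]
    · rw [max_eq_left h]
      have h6 : (14 / 5 : ℝ) ^ (m - 1) ≤ √d ^ (m - 1) := by gcongr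
      have h7 : √(d : ℝ) ^ m = √d ^ (m - 1) * √d := by
        rw [← pow_succ]; congr 1; omega
      have h8 := pow_bound_two hm
      rw [h7]
      nlinarith

/-! ### Polynomial approximation of the defect. -/

lemma sum_mul_abs_le {v : Fin d → ℝ} (hv : ∑ i, v i ^ 2 ≤ 1) : (∑ i, |v i|) ^ 2 ≤ d := by
  have h := Finset.sum_mul_sq_le_sq_mul_sq Finset.univ (fun _ : Fin d => (1 : ℝ)) (fun i => |v i|)
  simp only [one_mul, one_pow, Finset.sum_const, Finset.card_univ, Fintype.card_fin, nsmul_eq_mul,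
    mul_one, sq_abs] at h
  exact h.trans (mul_le_of_le_one_right (Nat.cast_nonneg d) hv)

section

variable {X : Set (E d)} {m : ℕ} {f : E d → ℝ} {K : Fin d → ℝ}

lemma abs_dlist_le_of_perm (hX : IsOpen X) (hf : ContDiffOn ℝ (m + 2 : ℕ) f X)
    (hK : ∀ i, ∀ l : List (Fin d), l.length = m → ∀ x ∈ X, |dlist l (dpart i (dpart i f)) x| ≤ K i)
    {L l : List (Fin d)} {c : Fin d} (h : L.Perm (c :: c :: l)) (hl : l.length = m) {x : E d}
    (hx : x ∈ X) : |dlist L f x| ≤ K c := by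
  have hL : L.length = m + 2 := by rw [h.length_eq]; simp [hl]
  rw [dlist_perm hX h (by rw [hL]; exact hf) hx]
  exact hK c l hl x hx

/-- A list of `m + 2 > d` indices has a repeated one by the pigeonhole principle; moving both copies
to the front exposes `∂_c² f`. -/
lemma abs_dlist_le_of_le (hX : IsOpen X) (hf : ContDiffOn ℝ (m + 2 : ℕ) f X) (hK0 : ∀ i, 0 ≤ K i)
    (hK : ∀ i, ∀ l : List (Fin d), l.length = m → ∀ x ∈ X, |dlist l (dpart i (dpart i f)) x| ≤ K i)
    (hd : d ≤ m + 1) {L : List (Fin d)} (hL : L.length = m + 2) {x : E d} (hx : x ∈ X) :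
    |dlist L f x| ≤ ∑ i, K i := by
  have hnd : ¬ L.Nodup := fun h => by
    have := h.length_le_card
    simp at this; omega
  obtain ⟨c, hc⟩ := List.exists_duplicate_iff_not_nodup.2 hnd
  have hsub := List.duplicate_iff_sublist.1 hc
  obtain ⟨l, hl⟩ := hsub.exists_perm_append
  have hlen := hl.length_eq
  simp only [List.length_append, List.length_cons, List.length_nil] at hlen
  exact (abs_dlist_le_of_perm hX hf hK (l := l) (c := c) (by simpa using hl) (by omega) hx).trans
    (Finset.single_le_sum (f := K) (fun i _ => hK0 i) (Finset.mem_univ c))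

/-- The difference between the second derivative of `f` along `v` and the model `b`. -/
def defect (f : E d → ℝ) (v : Fin d → ℝ) (b : E d → ℝ) (x : E d) : ℝ :=
  ∑ i, ∑ j, v i * v j * dpart i (dpart j f) x - b x

lemma abs_quadratic_le {v : Fin d → ℝ} (hv : ∑ i, v i ^ 2 ≤ 1) {e : Fin d → Fin d → ℝ} {S : ℝ}
    (hS : 0 ≤ S) (he : ∀ i j, |e i j| ≤ S) : |∑ i, ∑ j, v i * v j * e i j| ≤ d * S := by
  calc |∑ i, ∑ j, v i * v j * e i j| ≤ ∑ i, ∑ j, |v i| * |v j| * S := by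
        refine (Finset.abs_sum_le_sum_abs _ _).trans (Finset.sum_le_sum fun i _ => ?_)
        refine (Finset.abs_sum_le_sum_abs _ _).trans (Finset.sum_le_sum fun j _ => ?_)
        rw [abs_mul, abs_mul]
        gcongr
        exact he i j
    _ = (∑ i, |v i|) ^ 2 * S := by
        rw [sq, Finset.sum_mul_sum, Finset.sum_mul]
        simp only [Finset.sum_mul]
    _ ≤ d * S := by gcongr; exact sum_mul_abs_le hv

variable {v : Fin d → ℝ} {b : E d → ℝ} {Kb : ℝ}

/-- The Taylor polynomial of `defect`. -/
def defectTaylor (m : ℕ) (f : E d → ℝ) (v : Fin d → ℝ) (b : E d → ℝ) (c x : E d) : ℝ :=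
  ∑ i, ∑ j, v i * v j * taylorPoly m (dpart i (dpart j f)) c x - taylorPoly m b c x

lemma dpart_dpart_contDiffOn (hX : IsOpen X) (hf : ContDiffOn ℝ (m + 2 : ℕ) f X) (i j : Fin d) :
    ContDiffOn ℝ m (dpart i (dpart j f)) X :=
  dpart_contDiffOn hX (dpart_contDiffOn hX hf j) i

lemma abs_defect_sub_taylor_le (hX : IsOpen X) (hf : ContDiffOn ℝ (m + 2 : ℕ) f X)
    (hK0 : ∀ i, 0 ≤ K i)
    (hK : ∀ i, ∀ l : List (Fin d), l.length = m → ∀ x ∈ X, |dlist l (dpart i (dpart i f)) x| ≤ K i)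
    (hd : d ≤ m + 1) (hd1 : 1 ≤ d) (hv : ∑ i, v i ^ 2 ≤ 1) (hb : ContDiffOn ℝ m b X) (hKb0 : 0 ≤ Kb)
    (hKb : ∀ l : List (Fin d), l.length = m → ∀ x ∈ X, |dlist l b x| ≤ Kb) {c x : E d} {ρ : ℝ}
    (hρ : 0 ≤ ρ) (hseg : ∀ t ∈ Set.Icc (0 : ℝ) 1, c + t • (x - c) ∈ X) (hx : ‖x - c‖ ≤ ρ) :
    |defect f v b x - defectTaylor m f v b c x| ≤
      (√d * ρ) ^ m / m.factorial * d * (∑ i, K i + Kb) := by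
  have hS : 0 ≤ ∑ i, K i := Finset.sum_nonneg fun i _ => hK0 i
  have h1 (i j : Fin d) := abs_sub_taylorPoly_le_of_segment hX (dpart_dpart_contDiffOn hX hf i j)
    hseg hS (fun l hl t ht => abs_dlist_le_of_le hX hf hK0 hK hd (L := j :: i :: l)
      (by simp [hl]) (hseg t ht)) hx
  have h2 := abs_sub_taylorPoly_le_of_segment hX hb hseg hKb0
    (fun l hl t ht => hKb l hl _ (hseg t ht)) hx
  have h3 := abs_quadratic_le hv (by positivity) h1
  have e : defect f v b x - defectTaylor m f v b c x =
      ∑ i, ∑ j, v i * v j * (dpart i (dpart j f) x - taylorPoly m (dpart i (dpart j f)) c x)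
        - (b x - taylorPoly m b c x) := by
    simp only [defect, defectTaylor, mul_sub, Finset.sum_sub_distrib]; ring
  rw [e]
  refine (abs_sub _ _).trans ((add_le_add h3 h2).trans ?_)
  have hq : 0 ≤ (√d * ρ) ^ m / m.factorial := by positivity
  have hd1' : (1 : ℝ) ≤ d := by exact_mod_cast hd1
  have : (√d * ρ) ^ m / m.factorial * Kb ≤ (√d * ρ) ^ m / m.factorial * (d * Kb) := by
    gcongr
    nlinarith
  calc _ = d * ((√d * ρ) ^ m / m.factorial * ∑ i, K i) + (√d * ρ) ^ m / m.factorial * Kb := by ring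
    _ ≤ _ := by linarith

lemma exists_approx_of_le (hX : IsOpen X) (hf : ContDiffOn ℝ (m + 2 : ℕ) f X)
    (hK0 : ∀ i, 0 ≤ K i)
    (hK : ∀ i, ∀ l : List (Fin d), l.length = m → ∀ x ∈ X, |dlist l (dpart i (dpart i f)) x| ≤ K i)
    (hd : d ≤ m + 1) (hd1 : 1 ≤ d) (hv : ∑ i, v i ^ 2 ≤ 1) (hb : ContDiffOn ℝ m b X) (hKb0 : 0 ≤ Kb)
    (hKb : ∀ l : List (Fin d), l.length = m → ∀ x ∈ X, |dlist l b x| ≤ Kb) {c : E d} {ρ : ℝ}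
    (hρ : 0 < ρ) (hball : Metric.closedBall c ρ ⊆ X) :
    ∃ P : E d → ℝ, Continuous P ∧ IsLinePoly (m - 1) P ∧ ∀ x ∈ Metric.closedBall c ρ,
      |defect f v b x - P x| ≤ (√d * ρ) ^ m / m.factorial * d * (∑ i, K i + Kb) := by
  have hc : c ∈ X := hball (Metric.mem_closedBall_self hρ.le)
  have hT (u : E d → ℝ) := (taylorPoly_differentiable hX m u hc).continuous
  refine ⟨defectTaylor m f v b c, ?_, ?_, fun x hx => ?_⟩
  · unfold defectTaylor
    exact (continuous_finsetSum _ fun i _ => continuous_finsetSum _ fun j _ =>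
      continuous_const.mul (hT _)).sub (hT b)
  · have h := (IsLinePoly.sum Finset.univ fun i _ => IsLinePoly.sum Finset.univ fun j _ =>
      (isLinePoly_taylorPoly m (dpart i (dpart j f)) c).const_mul (v i * v j)).add
      ((isLinePoly_taylorPoly m b c).const_mul (-1))
    have e : defectTaylor m f v b c = fun x => ∑ i, ∑ j, v i * v j *
        taylorPoly m (dpart i (dpart j f)) c x + -1 * taylorPoly m b c x := by
      funext x; simp only [defectTaylor]; ring
    rw [e]
    exact h
  · exact abs_defect_sub_taylor_le hX hf hK0 hK hd hd1 hv hb hKb0 hKb hρ.le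
      (fun t ht => hball (segment_mem_closedBall hx ht)) (mem_closedBall_iff_norm.1 hx)

/-- The factor `d` is the price `(∑ |v i|)² ≤ d` of the quadratic form. Writing `d = √d²` absorbs it
into `(√d ρ) ^ (m + 2)`; the ratios of factorials leave exactly the two entries of the maximum in
`lossFactor`. -/
lemma abs_offdiag_bound {d m : ℕ} {ρ : ℝ} (hρ : 0 < ρ) {K : Fin d → ℝ} (hK0 : ∀ i, 0 ≤ K i)
    {a b : Fin d} (hab : a ≠ b) :
    d * ((K a * (√d * ρ) ^ (m + 1) / (m + 1).factorial
          + K b * (√d * ρ) ^ (m + 1) / (m + 1).factorial) * ρ +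
        (49 / 40) ^ (d - 2) * (∑ i ∈ (Finset.univ.erase a).erase b,
          K i * (√d * ρ) ^ m / m.factorial * ρ ^ 2 / 2)) ≤
      (√d * ρ) ^ (m + 2) / (m + 2).factorial * (lossFactor d (m + 2) - 1) * ∑ i, K i := by
  have hd0 : (0 : ℝ) < d := by exact_mod_cast a.pos
  set s := √(d : ℝ) with hs
  have hs0 : 0 < s := Real.sqrt_pos.2 hd0
  have hsd : (d : ℝ) = s ^ 2 := (Real.sq_sqrt hd0.le).symm
  set μ := max (((m + 2 : ℕ) : ℝ) * s) ((49 / 40) ^ (d - 2) * (((m + 2 : ℕ) : ℝ) * ((m + 2 : ℕ) - 1)) / 2)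
    with hμ
  have hloss : lossFactor d (m + 2) - 1 = μ := by rw [lossFactor]; ring
  have hsum : ∑ i, K i = K a + (K b + ∑ i ∈ (Finset.univ.erase a).erase b, K i) := by
    rw [← Finset.add_sum_erase _ _ (Finset.mem_univ a), ← Finset.add_sum_erase _ _
      (show b ∈ Finset.univ.erase a by simp [hab.symm])]
  set T := ∑ i ∈ (Finset.univ.erase a).erase b, K i with hT
  have hT0 : 0 ≤ T := Finset.sum_nonneg fun i _ => hK0 i
  have hTe : ∑ i ∈ (Finset.univ.erase a).erase b, K i * (s * ρ) ^ m / m.factorial * ρ ^ 2 / 2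
      = T * ((s * ρ) ^ m / m.factorial * ρ ^ 2 / 2) := by
    rw [hT, Finset.sum_mul]
    exact Finset.sum_congr rfl fun i _ => by ring
  have hf0 : (m.factorial : ℝ) ≠ 0 := by positivity
  have hm1 : ((m : ℝ) + 1) ≠ 0 := by positivity
  have hm2 : ((m : ℝ) + 2) ≠ 0 := by positivity
  have f1 : ((m + 1).factorial : ℝ) = (m + 1) * m.factorial := by
    rw [Nat.factorial_succ]; push_cast; ring
  have f2 : ((m + 2).factorial : ℝ) = (m + 2) * ((m + 1) * m.factorial) := by
    rw [Nat.factorial_succ, Nat.cast_mul, f1]; push_cast; ring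
  set q := (s * ρ) ^ (m + 2) / (m + 2).factorial with hq
  have hq0 : 0 ≤ q := by positivity
  have e1 : (d : ℝ) * ((s * ρ) ^ (m + 1) / (m + 1).factorial * ρ) = q * (((m + 2 : ℕ) : ℝ) * s) := by
    rw [hq, f1, f2, hsd]
    push_cast
    field_simp
    ring
  have e2 : (d : ℝ) * ((49 / 40) ^ (d - 2) * ((s * ρ) ^ m / m.factorial * ρ ^ 2 / 2))
      = q * ((49 / 40) ^ (d - 2) * (((m + 2 : ℕ) : ℝ) * ((m + 2 : ℕ) - 1)) / 2) := by
    rw [hq, f2]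
    generalize (49 / 40 : ℝ) ^ (d - 2) = Λ
    rw [hsd]
    push_cast
    field_simp
    ring
  rw [hTe, hloss, hsum]
  calc _ = (K a + K b) * (d * ((s * ρ) ^ (m + 1) / (m + 1).factorial * ρ)) +
        T * (d * ((49 / 40) ^ (d - 2) * ((s * ρ) ^ m / m.factorial * ρ ^ 2 / 2))) := by ring
    _ ≤ (K a + K b) * (q * μ) + T * (q * μ) := by
        rw [e1, e2]
        have := hK0 a
        have := hK0 b
        gcongr
        · exact le_max_left _ _
        · exact le_max_right _ _
    _ = _ := by ring

lemma exists_approx_of_ge (hX : IsOpen X) (hf : ContDiffOn ℝ (m + 2 : ℕ) f X)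
    (hK0 : ∀ i, 0 ≤ K i)
    (hK : ∀ i, ∀ l : List (Fin d), l.length = m → ∀ x ∈ X, |dlist l (dpart i (dpart i f)) x| ≤ K i)
    (hm : 2 ≤ m) (hd : m + 2 ≤ d) (hv : ∑ i, v i ^ 2 ≤ 1) (hb : ContDiffOn ℝ m b X) (hKb0 : 0 ≤ Kb)
    (hKb : ∀ l : List (Fin d), l.length = m → ∀ x ∈ X, |dlist l b x| ≤ Kb) {c : E d} {ρ : ℝ}
    (hρ : 0 < ρ) (hball : Metric.closedBall c ρ ⊆ X) :
    ∃ P : E d → ℝ, Continuous P ∧ IsLinePoly (d - 2) P ∧ ∀ x ∈ Metric.closedBall c ρ,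
      |defect f v b x - P x| ≤
        (√d * ρ) ^ m / m.factorial * lossFactor d m * (∑ i, K i + Kb) := by
  obtain ⟨m, rfl⟩ : ∃ k, m = k + 2 := ⟨m - 2, by omega⟩
  have hc : c ∈ X := hball (Metric.mem_closedBall_self hρ.le)
  have hS : 0 ≤ ∑ i, K i := Finset.sum_nonneg fun i _ => hK0 i
  have hT (u : E d → ℝ) := (taylorPoly_differentiable hX (m + 2) u hc).continuous
  -- Every derivative of `∂_i ∂_j f` used here repeats an index: `k` by two differentiations in that
  -- direction, or `i` or `j` by a single one.
  have hoff (i j : Fin d) (hij : i ≠ j) := exists_offdiag_approx hX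
    (dpart_dpart_contDiffOn hX hf i j) hρ hball hij (by omega) hK0
    (fun k _ _ l hl x hx => abs_dlist_le_of_perm hX hf hK (L := j :: i :: k :: k :: l)
      (l := j :: i :: l) (c := k) (List.perm_iff_count.2 fun a => by
        simp only [List.count_cons]; omega) (by simp [hl]) (hball hx))
    (fun l hl x hx => abs_dlist_le_of_perm hX hf hK (L := j :: i :: i :: l)
      (l := j :: l) (c := i) (List.perm_iff_count.2 fun a => by
        simp only [List.count_cons]; omega) (by simp [hl]) (hball hx))
    (fun l hl x hx => abs_dlist_le_of_perm hX hf hK (L := j :: i :: j :: l)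
      (l := i :: l) (c := j) (List.perm_iff_count.2 fun a => by
        simp only [List.count_cons]; omega) (by simp [hl]) (hball hx))
  set q := (√d * ρ) ^ (m + 2) / (m + 2).factorial with hq
  have hq0 : 0 ≤ q := by positivity
  have hall (i j : Fin d) : ∃ P : E d → ℝ, Continuous P ∧ IsLinePoly (d - 2) P ∧
      (i = j → ∀ x ∈ Metric.closedBall c ρ, |dpart i (dpart j f) x - P x| ≤ q * K i) ∧
      (i ≠ j → ∀ x ∈ Metric.closedBall c ρ,
        d * |dpart i (dpart j f) x - P x| ≤ q * (lossFactor d (m + 2) - 1) * ∑ i, K i) := by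
    by_cases hij : i = j
    · subst hij
      refine ⟨_, hT (dpart i (dpart i f)), (isLinePoly_taylorPoly _ _ c).mono (by omega),
        fun _ x hx => ?_, fun h => absurd rfl h⟩
      refine (abs_sub_taylorPoly_le hX (dpart_dpart_contDiffOn hX hf i i) hball (hK0 i)
        (fun l hl x hx => hK i l hl x (hball hx)) hx).trans_eq ?_
      rw [hq]; ring
    · obtain ⟨P, hPc, hPl, hP⟩ := hoff i j hij
      refine ⟨P, hPc, hPl.mono (max_le (by omega) le_rfl), fun h => absurd h hij, fun _ x hx => ?_⟩
      exact (mul_le_mul_of_nonneg_left (hP x hx) (Nat.cast_nonneg d)).trans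
        (abs_offdiag_bound hρ hK0 hij)
  choose P hPc hPl hPd hPo using hall
  refine ⟨fun x => ∑ i, ∑ j, v i * v j * P i j x + -1 * taylorPoly (m + 2) b c x, ?_, ?_,
    fun x hx => ?_⟩
  · exact (continuous_finsetSum _ fun i _ => continuous_finsetSum _ fun j _ =>
      continuous_const.mul (hPc i j)).add (continuous_const.mul (hT b))
  · exact (IsLinePoly.sum Finset.univ fun i _ => IsLinePoly.sum Finset.univ fun j _ =>
      (hPl i j).const_mul (v i * v j)).add
      (((isLinePoly_taylorPoly (m + 2) b c).mono (by omega)).const_mul (-1))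
  · have hbT := abs_sub_taylorPoly_le hX hb hball hKb0 (fun l hl x hx => hKb l hl x (hball hx)) hx
    set e : Fin d → Fin d → ℝ := fun i j => dpart i (dpart j f) x - P i j x with he
    have hd0 : (0 : ℝ) < d := by exact_mod_cast (by omega : 0 < d)
    have hloss1 : 1 ≤ lossFactor d (m + 2) := by
      unfold lossFactor
      have : (0 : ℝ) ≤ ((m + 2 : ℕ) : ℝ) * √d := by positivity
      linarith [this.trans (le_max_left _ ((49 / 40 : ℝ) ^ (d - 2) *
        (((m + 2 : ℕ) : ℝ) * (((m + 2 : ℕ) : ℝ) - 1)) / 2))]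
    set μ := lossFactor d (m + 2) - 1 with hμ
    have hμ0 : 0 ≤ μ := by linarith
    -- Diagonal terms carry weights `v i ^ 2` of sum at most 1 and so avoid the factor `d`; they
    -- account for the summand 1 in `lossFactor`.
    have hsplit : ∑ i, ∑ j, v i * v j * e i j = ∑ i, v i ^ 2 * e i i +
        ∑ i, ∑ j, v i * v j * (if i = j then 0 else e i j) := by
      rw [← Finset.sum_add_distrib]
      refine Finset.sum_congr rfl fun i _ => ?_
      have : ∑ j, v i * v j * e i j = ∑ j, ((if i = j then v i ^ 2 * e i i else 0) +
          v i * v j * (if i = j then 0 else e i j)) := by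
        refine Finset.sum_congr rfl fun j _ => ?_
        by_cases h : i = j
        · subst h; simp only [if_true]; ring
        · simp [h]
      rw [this, Finset.sum_add_distrib]; simp
    have hdiag : |∑ i, v i ^ 2 * e i i| ≤ q * ∑ i, K i := by
      rw [Finset.mul_sum]
      refine (Finset.abs_sum_le_sum_abs _ _).trans (Finset.sum_le_sum fun i _ => ?_)
      rw [abs_mul, abs_of_nonneg (sq_nonneg _)]
      have : v i ^ 2 ≤ 1 := (Finset.single_le_sum (f := fun i => v i ^ 2)
        (fun i _ => sq_nonneg _) (Finset.mem_univ i)).trans hv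
      exact (mul_le_of_le_one_left (abs_nonneg _) this).trans (hPd i i rfl x hx)
    have hoffd := abs_quadratic_le hv (e := fun i j => if i = j then 0 else e i j)
      (S := q * μ * (∑ i, K i) / d) (by positivity) (fun i j => by
        by_cases h : i = j
        · simp only [h, if_true, abs_zero]; positivity
        · simp only [h, if_false]
          rw [le_div_iff₀ hd0, mul_comm]
          exact hPo i j h x hx)
    rw [mul_div_cancel₀ _ hd0.ne'] at hoffd
    have e1 : defect f v b x - (∑ i, ∑ j, v i * v j * P i j x + -1 * taylorPoly (m + 2) b c x)
        = ∑ i, ∑ j, v i * v j * e i j - (b x - taylorPoly (m + 2) b c x) := by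
      simp only [defect, he, mul_sub, Finset.sum_sub_distrib]; ring
    rw [e1, hsplit]
    have hbT' : |b x - taylorPoly (m + 2) b c x| ≤ q * Kb := hbT.trans_eq (by rw [hq]; ring)
    calc _ ≤ (q * ∑ i, K i + q * μ * ∑ i, K i) + q * Kb :=
          (abs_sub _ _).trans (add_le_add ((abs_add_le _ _).trans (add_le_add hdiag hoffd)) hbT')
      _ = q * (1 + μ) * (∑ i, K i) + q * Kb := by ring
      _ ≤ q * (1 + μ) * (∑ i, K i) + q * (1 + μ) * Kb := by
          have : q * Kb ≤ q * (1 + μ) * Kb := by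
            rw [mul_assoc]
            gcongr
            nlinarith
          linarith
      _ = _ := by rw [hμ]; ring

end

/-! ### Geometry of the domain and the scattered-zeros estimate. -/

lemma IsUnionOfBalls.isOpen {X : Set (E d)} {r : ℝ} (hX : IsUnionOfBalls X r) : IsOpen X := by
  obtain ⟨_, S, _, rfl⟩ := hX
  exact isOpen_biUnion fun _ _ => Metric.isOpen_ball

lemma IsUnionOfBalls.exists_ball {X : Set (E d)} {r : ℝ} (hX : IsUnionOfBalls X r) {x : E d}
    (hx : x ∈ X) : ∃ y, ‖x - y‖ < r ∧ ∀ z, ‖z - y‖ < r → z ∈ X := by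
  obtain ⟨_, S, _, rfl⟩ := hX
  obtain ⟨y, hy, hxy⟩ := Set.mem_iUnion₂.1 hx
  exact ⟨y, mem_ball_iff_norm.1 hxy,
    fun z hz => Set.mem_iUnion₂.2 ⟨y, hy, mem_ball_iff_norm.2 hz⟩⟩

lemma IsUnionOfBalls.exists_closedBall {X : Set (E d)} {r : ℝ} (hX : IsUnionOfBalls X r) {x : E d}
    (hx : x ∈ X) {ρ : ℝ} (hρ : 0 < ρ) (hρr : ρ < r) :
    ∃ c, x ∈ Metric.closedBall c ρ ∧ Metric.closedBall c ρ ⊆ X := by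
  obtain ⟨y, hxy, hy⟩ := hX.exists_ball hx
  have hr : 0 < r := hX.1
  have h1 : ρ / r < 1 := (div_lt_one hr).2 hρr
  have h2 : ρ / r * r = ρ := div_mul_cancel₀ _ hr.ne'
  have h0 : 0 < ρ / r := div_pos hρ hr
  set τ := ρ / r
  -- This is the image of `y` under the homothety of ratio `ρ / r` centred at `x`, which shrinks the
  -- ball around `y` into itself and fixes `x`.
  refine ⟨y + (1 - τ) • (x - y), ?_, fun z hz => hy z ?_⟩
  · rw [mem_closedBall_iff_norm, show x - (y + (1 - τ) • (x - y)) = τ • (x - y) by module,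
      norm_smul, Real.norm_of_nonneg h0.le]
    nlinarith
  · rw [mem_closedBall_iff_norm] at hz
    have h3 : ‖z - y‖ ≤ ‖z - (y + (1 - τ) • (x - y))‖ + ‖(1 - τ) • (x - y)‖ := by
      refine (le_of_eq ?_).trans (norm_add_le _ _)
      congr 1; module
    rw [norm_smul, Real.norm_of_nonneg (by linarith)] at h3
    nlinarith

/-- Moving `x` toward the centre of its ball by the fraction `h / r` leaves room for a node within
`h`. That node lies in the closed ball of radius `r` and in `X`; the rest of its segment to `x` is
in the open ball. -/
lemma IsUnionOfBalls.exists_near_segment {X : Set (E d)} {r : ℝ} (hX : IsUnionOfBalls X r)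
    {Z : Set (E d)} (hZX : Z ⊆ X) {h : ℝ} (hh : 0 < h) (hhr : h ≤ r)
    (hZ : ∀ x ∈ X, ∃ z ∈ Z, ‖z - x‖ ≤ h) {x : E d} (hx : x ∈ X) :
    ∃ z ∈ Z, ‖x - z‖ ≤ 2 * h ∧ ∀ t ∈ Set.Icc (0 : ℝ) 1, z + t • (x - z) ∈ X := by
  obtain ⟨y, hxy, hy⟩ := hX.exists_ball hx
  have hr : 0 < r := hX.1
  have h1 : h / r ≤ 1 := (div_le_one hr).2 hhr
  have h2 : h / r * r = h := div_mul_cancel₀ _ hr.ne'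
  have h0 : 0 < h / r := div_pos hh hr
  set τ := h / r
  have hy' : ‖y + (1 - τ) • (x - y) - y‖ = (1 - τ) * ‖x - y‖ := by
    rw [add_sub_cancel_left, norm_smul, Real.norm_of_nonneg (by linarith)]
  obtain ⟨z, hz, hzy⟩ := hZ _ (hy (y + (1 - τ) • (x - y)) (by
    rw [hy']; nlinarith [norm_nonneg (x - y)]))
  have hzr : ‖z - y‖ ≤ r := by
    have h3 : ‖z - y‖ ≤ ‖z - (y + (1 - τ) • (x - y))‖ + ‖y + (1 - τ) • (x - y) - y‖ :=
      norm_sub_le_norm_sub_add_norm_sub _ _ _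
    rw [hy'] at h3
    nlinarith
  refine ⟨z, hz, ?_, fun t ht => ?_⟩
  · have h3 : ‖x - z‖ ≤ ‖z - (y + (1 - τ) • (x - y))‖ + ‖τ • (x - y)‖ := by
      rw [← norm_neg (z - _)]
      refine (le_of_eq ?_).trans (norm_add_le _ _)
      congr 1; module
    rw [norm_smul, Real.norm_of_nonneg h0.le] at h3
    nlinarith
  · rcases ht.1.eq_or_lt with rfl | ht0
    · simpa using hZX hz
    · refine hy _ ?_
      have h3 : ‖z + t • (x - z) - y‖ ≤ ‖(1 - t) • (z - y)‖ + ‖t • (x - y)‖ := by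
        refine (le_of_eq ?_).trans (norm_add_le _ _)
        congr 1; module
      rw [norm_smul, norm_smul, Real.norm_of_nonneg ht.1,
        Real.norm_of_nonneg (by linarith [ht.2])] at h3
      nlinarith [ht.2]

lemma abs_le_of_norming {G P : E d → ℝ} {N : ℕ} (hPc : Continuous P) (hP : IsLinePoly N P) {c : E d}
    {ρ h κ ε : ℝ} (hh : 0 < h) (hρ : 5 * h ≤ ρ)
    (h1 : 6 * N ^ 2 * h ≤ κ * (8 / 5 * ρ - 3 * h)) (h2 : 2 * N ^ 2 * h ≤ κ * (3 / 5 * ρ - h))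
    (hκ : κ < 1) {Z : Set (E d)} (hZ : ∀ x ∈ Metric.closedBall c ρ, ∃ z ∈ Z, ‖z - x‖ ≤ h)
    (hG : ∀ z ∈ Z, G z = 0) (hGP : ∀ x ∈ Metric.closedBall c ρ, |G x - P x| ≤ ε) {x : E d}
    (hx : x ∈ Metric.closedBall c ρ) : |G x| ≤ (1 + 1 / (1 - κ)) * ε := by
  have h3 := norming hP hPc hh hZ hρ h1 h2 (e := ε)
    (fun z hz hzb => by simpa [hG z hz] using hGP z hzb) hx
  have h4 : |P x| ≤ ε / (1 - κ) := by
    rw [le_div_iff₀ (by linarith)]; linarith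
  calc |G x| = |(G x - P x) + P x| := by rw [sub_add_cancel]
    _ ≤ ε + ε / (1 - κ) := (abs_add_le _ _).trans (add_le_add (hGP x hx) h4)
    _ = _ := by ring

/-- One `√d ^ m` comes from Taylor's formula, the other from `A * F`; together they form the `d ^ m`
of `constC0`. -/
lemma scaled_bound_le_constC0 {m : ℕ} {h A F S : ℝ} (hh : 0 ≤ h) (hS : 0 ≤ S)
    (hAF : A * F ≤ 3 * √d ^ m) :
    A * ((√d * (17 * ((m : ℝ) - 1) ^ 2 * h)) ^ m / m.factorial * F * S) ≤
      constC0 d m * h ^ m * S := by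
  have hm1 : (0 : ℝ) ≤ ((m : ℝ) - 1) ^ 2 := sq_nonneg _
  have e1 : √(d : ℝ) ^ m * √d ^ m = (d : ℝ) ^ m := by
    rw [← mul_pow, Real.mul_self_sqrt (Nat.cast_nonneg d)]
  calc _ = A * F * (√d ^ m * (17 * ((m : ℝ) - 1) ^ 2) ^ m * h ^ m / m.factorial * S) := by
        rw [mul_pow, mul_pow]; ring
    _ ≤ 3 * √d ^ m * (√d ^ m * (max 1 (18 * ((m : ℝ) - 1) ^ 2)) ^ m * h ^ m / m.factorial * S) := by
        gcongr
        exact (by linarith : 17 * ((m : ℝ) - 1) ^ 2 ≤ 18 * ((m : ℝ) - 1) ^ 2).trans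
          (le_max_right _ _)
    _ = 3 * ((√d ^ m * √d ^ m) / m.factorial) * (max 1 (18 * ((m : ℝ) - 1) ^ 2)) ^ m * h ^ m * S := by
        ring
    _ = _ := by rw [e1, constC0]

section

variable {X : Set (E d)} {m : ℕ} {f : E d → ℝ} {K : Fin d → ℝ} {v : Fin d → ℝ} {b : E d → ℝ}
  {Kb : ℝ}

lemma abs_defect_le {r : ℝ} (hX : IsUnionOfBalls X r) (hf : ContDiffOn ℝ (m + 2 : ℕ) f X)
    (hK0 : ∀ i, 0 ≤ K i)
    (hK : ∀ i, ∀ l : List (Fin d), l.length = m → ∀ x ∈ X, |dlist l (dpart i (dpart i f)) x| ≤ K i)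
    (hdm : d < 2 * m) (hd1 : 1 ≤ d) (hv : ∑ i, v i ^ 2 ≤ 1) (hb : ContDiffOn ℝ m b X)
    (hKb0 : 0 ≤ Kb) (hKb : ∀ l : List (Fin d), l.length = m → ∀ x ∈ X, |dlist l b x| ≤ Kb)
    {Z : Set (E d)} (hZX : Z ⊆ X) {h : ℝ} (hh : 0 < h)
    (hZ : ∀ x ∈ X, ∃ z ∈ Z, ‖z - x‖ ≤ h) (hhr : h ≤ r)
    (hmr : 2 ≤ m → 18 * ((m : ℝ) - 1) ^ 2 * h ≤ r) (h0 : ∀ z ∈ Z, defect f v b z = 0) {x : E d}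
    (hx : x ∈ X) : |defect f v b x| ≤ constC0 d m * h ^ m * (∑ i, K i + Kb) := by
  have hS : 0 ≤ ∑ i, K i + Kb := add_nonneg (Finset.sum_nonneg fun i _ => hK0 i) hKb0
  have hXo := hX.isOpen
  obtain rfl | hm : m = 1 ∨ 2 ≤ m := by omega
  -- With `m = 1` the Taylor polynomial is the value at a node, so the bound follows along a segment
  -- of length at most `2h`, and `2 ≤ 3 = constC0 1 1`.
  · obtain rfl : d = 1 := by omega
    obtain ⟨z, hz, hzx, hseg⟩ := hX.exists_near_segment hZX hh hhr hZ hx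
    have h1 := abs_defect_sub_taylor_le hXo hf hK0 hK (by omega) le_rfl hv hb hKb0 hKb
      (by positivity) hseg hzx
    have e : defectTaylor 1 f v b z x = defect f v b z := by
      simp [defectTaylor, defect, taylorPoly, hom]
    rw [e, h0 z hz, sub_zero] at h1
    refine h1.trans ?_
    have : constC0 1 1 = 3 := by norm_num [constC0]
    rw [this]
    generalize ∑ i, K i + Kb = S at hS ⊢
    norm_num
    nlinarith [mul_nonneg hh.le hS]
  · have hm' : (2 : ℝ) ≤ m := by exact_mod_cast hm
    have hx1 : (1 : ℝ) ≤ ((m : ℝ) - 1) ^ 2 := by nlinarith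
    -- The constant 17 instead of 18 makes `ρ < r` strict, as a closed ball inside `X` requires.
    set ρ := 17 * ((m : ℝ) - 1) ^ 2 * h with hρ
    have hρ0 : 0 < ρ := by positivity
    have hxh : h ≤ ((m : ℝ) - 1) ^ 2 * h := le_mul_of_one_le_left hh.le hx1
    have hρr : ρ < r := by have := hmr hm; rw [hρ]; linarith
    obtain ⟨c, hxc, hcX⟩ := hX.exists_closedBall hx hρ0 hρr
    have hZ' : ∀ x ∈ Metric.closedBall c ρ, ∃ z ∈ Z, ‖z - x‖ ≤ h := fun x hx => hZ x (hcX hx)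
    have h5 : 5 * h ≤ ρ := by rw [hρ]; linarith
    rcases Nat.lt_or_ge d (m + 2) with hdm2 | hdm2
    · obtain ⟨P, hPc, hPl, hP⟩ := exists_approx_of_le hXo hf hK0 hK (by omega) hd1 hv hb hKb0 hKb
        hρ0 hcX
      have hN : ((m - 1 : ℕ) : ℝ) = m - 1 := by rw [Nat.cast_sub (by omega)]; simp
      -- The degree is `m - 1`, so `κ = 1/4` is admissible; the loss is `7/3 · d ≤ 3 √d ^ m`, using
      -- `m ≥ 2`.
      refine (abs_le_of_norming (κ := 1 / 4) hPc hPl hh h5 ?_ ?_ (by norm_num) hZ' h0 hP hxc).trans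
        (scaled_bound_le_constC0 hh.le hS ?_)
      · rw [hN, hρ]; linarith
      · rw [hN, hρ]; linarith
      · have hd1' : (1 : ℝ) ≤ d := by exact_mod_cast hd1
        have h6 : √(d : ℝ) ^ 2 ≤ √d ^ m := pow_le_pow_right₀ (Real.one_le_sqrt.2 hd1') hm
        rw [Real.sq_sqrt (by linarith)] at h6
        norm_num
        linarith
    · obtain ⟨κ, hκ, hκ1, hκ2, hκ3⟩ := exists_norming_constant hdm2 (by omega : d + 1 ≤ 2 * m)
      obtain ⟨P, hPc, hPl, hP⟩ := exists_approx_of_ge hXo hf hK0 hK hm hdm2 hv hb hKb0 hKb hρ0 hcX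
      refine (abs_le_of_norming hPc hPl hh h5 ?_ ?_ hκ hZ' h0 hP hxc).trans
        (scaled_bound_le_constC0 hh.le hS hκ3)
      · have := mul_le_mul_of_nonneg_right hκ1 hh.le
        rw [hρ]; linarith
      · have := mul_le_mul_of_nonneg_right hκ2 hh.le
        rw [hρ]; linarith

/-! ### From a Hessian bound to convexity. -/

lemma isConvexOn_of_quadratic_nonneg (hX : IsOpen X) (hf : ContDiffOn ℝ (2 : ℕ) f X) {η : ℝ}
    (h : ∀ x ∈ X, ∀ w : Fin d → ℝ,
      0 ≤ ∑ i, ∑ j, w i * w j * dpart i (dpart j f) x + η * ∑ i, w i ^ 2) :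
    IsConvexOn (fun x => f x + η / 2 * ‖x‖ ^ 2) X := by
  intro S hSX hS
  refine ⟨hS, fun x hx y hy a b ha hb hab => ?_⟩
  set w := y - x with hw
  have hmem {t : ℝ} (ht : t ∈ Set.Icc (0 : ℝ) 1) : x + t • w ∈ X :=
    hSX (hS.add_smul_sub_mem hx hy ht)
  have hn (t : ℝ) : ‖x + t • w‖ ^ 2 = ‖x‖ ^ 2 + 2 * t * inner ℝ x w + t ^ 2 * ‖w‖ ^ 2 := by
    rw [norm_add_sq_real, inner_smul_right, norm_smul, mul_pow, Real.norm_eq_abs, sq_abs]; ring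
  set φ : ℝ → ℝ := fun t => f (x + t • w) + η / 2 * ‖x + t • w‖ ^ 2 with hφ
  have hq1 (t : ℝ) : HasDerivAt (fun t => η / 2 * ‖x + t • w‖ ^ 2)
      (η / 2 * (2 * inner ℝ x w + 2 * t * ‖w‖ ^ 2)) t := by
    simp only [hn]
    have h1 := ((hasDerivAt_id t).const_mul 2).mul_const (inner ℝ x w)
    have h2 := ((hasDerivAt_id t).pow 2).mul_const (‖w‖ ^ 2)
    refine (((h1.const_add (‖x‖ ^ 2)).add h2).const_mul (η / 2)).congr_deriv ?_
    simp
  have hq2 (t : ℝ) : HasDerivAt (fun t => η / 2 * (2 * inner ℝ x w + 2 * t * ‖w‖ ^ 2))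
      (η * ‖w‖ ^ 2) t := by
    have h1 := ((hasDerivAt_id t).const_mul 2).mul_const (‖w‖ ^ 2)
    refine ((h1.const_add (2 * inner ℝ x w)).const_mul (η / 2)).congr_deriv ?_
    ring
  have hd1 (t : ℝ) (ht : t ∈ Set.Icc (0 : ℝ) 1) : HasDerivAt φ
      (hom 1 f (x + t • w) w + η / 2 * (2 * inner ℝ x w + 2 * t * ‖w‖ ^ 2)) t :=
    (hom_line_hasDerivAt hX (j := 0) (hf.of_le (by norm_cast)) x w (hmem ht)).add (hq1 t)
  have hd2 (t : ℝ) (ht : t ∈ Set.Icc (0 : ℝ) 1) : HasDerivAt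
      (fun t => hom 1 f (x + t • w) w + η / 2 * (2 * inner ℝ x w + 2 * t * ‖w‖ ^ 2))
      (hom 2 f (x + t • w) w + η * ‖w‖ ^ 2) t :=
    (hom_line_hasDerivAt hX (j := 1) hf x w (hmem ht)).add (hq2 t)
  have hconv : ConvexOn ℝ (Set.Icc (0 : ℝ) 1) φ := by
    refine convexOn_of_hasDerivWithinAt2_nonneg (convex_Icc 0 1)
      (fun t ht => (hd1 t ht).continuousAt.continuousWithinAt)
      (fun t ht => (hd1 t (interior_subset ht)).hasDerivWithinAt)
      (fun t ht => (hd2 t (interior_subset ht)).hasDerivWithinAt) fun t ht => ?_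
    have h1 := h _ (hmem (interior_subset ht)) w
    rw [← EuclideanSpace.real_norm_sq_eq] at h1
    have e : hom 2 f (x + t • w) w =
        ∑ i, ∑ j, w i * w j * dpart i (dpart j f) (x + t • w) := by
      rw [Finset.sum_comm]
      simp only [hom, Finset.mul_sum]
      exact Finset.sum_congr rfl fun i _ => Finset.sum_congr rfl fun j _ => by ring
    rw [e]
    exact h1
  have h01 := hconv.2 (Set.left_mem_Icc.2 zero_le_one) (Set.right_mem_Icc.2 zero_le_one) ha hb hab
  have e0 : φ 0 = f x + η / 2 * ‖x‖ ^ 2 := by simp [hφ]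
  have e1 : φ 1 = f y + η / 2 * ‖y‖ ^ 2 := by simp [hφ, hw]
  have e2 : φ (a • (0 : ℝ) + b • (1 : ℝ)) =
      f (a • x + b • y) + η / 2 * ‖a • x + b • y‖ ^ 2 := by
    have : x + (a • (0 : ℝ) + b • (1 : ℝ)) • w = a • x + b • y := by
      obtain rfl : a = 1 - b := by linarith
      simp only [smul_eq_mul, mul_zero, mul_one, zero_add, hw]
      module
    simp only [hφ, this]
  rw [e0, e1, e2] at h01
  exact h01

lemma quadratic_nonneg_of_unit {e : Fin d → Fin d → ℝ} {η : ℝ}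
    (h : ∀ v : Fin d → ℝ, ∑ i, v i ^ 2 = 1 → -η ≤ ∑ i, ∑ j, v i * v j * e i j) (w : Fin d → ℝ) :
    0 ≤ ∑ i, ∑ j, w i * w j * e i j + η * ∑ i, w i ^ 2 := by
  have hs0 : 0 ≤ ∑ i, w i ^ 2 := Finset.sum_nonneg fun i _ => sq_nonneg _
  rcases hs0.eq_or_lt with hs | hs
  · have hw : ∀ i, w i = 0 := fun i => by
      have := (Finset.sum_eq_zero_iff_of_nonneg fun i _ => sq_nonneg (w i)).1 hs.symm i
        (Finset.mem_univ i)
      simpa using this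
    simp [hw]
  · set s := √(∑ i, w i ^ 2) with hsdef
    have hs1 : 0 < s := Real.sqrt_pos.2 hs
    have hs2 : s ^ 2 = ∑ i, w i ^ 2 := Real.sq_sqrt hs0
    have h1 := h (fun i => w i / s) (by
      simp only [div_pow]
      rw [← Finset.sum_div, ← hs2, div_self (by positivity)])
    have e1 : ∑ i, ∑ j, w i / s * (w j / s) * e i j = (∑ i, ∑ j, w i * w j * e i j) / s ^ 2 := by
      simp only [Finset.sum_div]
      exact Finset.sum_congr rfl fun i _ => Finset.sum_congr rfl fun j _ => by field_simp
    rw [e1, le_div_iff₀ (by positivity)] at h1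
    rw [← hs2]
    linarith

end

/-! ### Translation of the extended-valued hypotheses. -/

lemma hessian_eqOn {X : Set (E d)} (hX : IsOpen X) {f : E d → ℝ} (hf : ContDiffOn ℝ (2 : ℕ) f X)
    {x : E d} (hx : x ∈ X) (i j : Fin d) : hessian f x i j = dpart i (dpart j f) x := by
  simp only [hessian, Matrix.of_apply]
  rw [pderiv_eq_dlist hX hf _ hx]
  simp [List.ofFn_succ]

lemma abs_dlist_le_seminormCm {X : Set (E d)} (hX : IsOpen X) {m : ℕ} {g g' : E d → ℝ}
    (hg : ContDiffOn ℝ m g X) (hgg' : Set.EqOn g' g X) (hfin : seminormCm X m g' ≠ ⊤)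
    {l : List (Fin d)} (hl : l.length = m) {x : E d} (hx : x ∈ X) :
    |dlist l g x| ≤ (seminormCm X m g').toReal := by
  obtain ⟨σ, rfl⟩ := exists_reverse_ofFn_eq l hl
  rw [← dlist_congr hX _ hgg' hx, ← pderiv_eq_dlist hX (hg.congr hgg') σ hx, ← Real.norm_eq_abs,
    ← toReal_enorm]
  refine ENNReal.toReal_mono hfin ?_
  exact le_iSup_of_le σ (le_iSup₂_of_le x hx le_rfl)

lemma exists_norm_sub_le_fillDistance {n : ℕ} {xs : Fin n → E d} {X : Set (E d)}
    (hfin : fillDistance xs X ≠ ⊤) {x : E d} (hx : x ∈ X) :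
    ∃ i, ‖xs i - x‖ ≤ (fillDistance xs X).toReal := by
  have h1 : ⨅ i, edist x (xs i) ≤ fillDistance xs X :=
    le_iSup₂ (f := fun x (_ : x ∈ X) => ⨅ i, edist x (xs i)) x hx
  rcases isEmpty_or_nonempty (Fin n) with hn | hn
  · rw [iInf_of_empty, top_le_iff] at h1
    exact absurd h1 hfin
  · obtain ⟨i, hi⟩ := exists_eq_ciInf_of_finite (f := fun i => edist x (xs i))
    refine ⟨i, ?_⟩
    rw [← hi, edist_dist] at h1
    rw [← dist_eq_norm, dist_comm]
    exact (ENNReal.ofReal_le_iff_le_toReal hfin).1 h1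

lemma ne_top_and_toReal_le_of_coe_le {a : ℝ≥0∞} {η : ℝ} (h : (a : EReal) ≤ (η : EReal)) :
    a ≠ ⊤ ∧ a.toReal ≤ η := by
  have ha : a ≠ ⊤ := by
    rintro rfl
    exact absurd h (by simp)
  refine ⟨ha, ?_⟩
  lift a to NNReal using ha
  rw [EReal.coe_nnreal_eq_coe_real] at h
  exact EReal.coe_le_coe_iff.1 h

lemma fillDistance_bounds {n m : ℕ} {xs : Fin n → E d} {X : Set (E d)} {r : ℝ} (hr : 0 < r)
    (hfill : fillDistance xs X ≤
      ENNReal.ofReal r * min 1 (1 / (18 * ((m - 1 : ℕ) : ENNReal) ^ 2))) :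
    fillDistance xs X ≠ ⊤ ∧ (fillDistance xs X).toReal ≤ r ∧
      (2 ≤ m → 18 * ((m : ℝ) - 1) ^ 2 * (fillDistance xs X).toReal ≤ r) := by
  have h1 : fillDistance xs X ≤ ENNReal.ofReal r :=
    hfill.trans ((mul_le_mul_right (min_le_left _ _) _).trans_eq (mul_one _))
  have hfin : fillDistance xs X ≠ ⊤ := ne_top_of_le_ne_top ENNReal.ofReal_ne_top h1
  refine ⟨hfin, ENNReal.toReal_le_of_le_ofReal hr.le h1, fun hm => ?_⟩
  have h2 := hfill.trans (mul_le_mul_right (min_le_right _ _) _)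
  have hm1 : ((m - 1 : ℕ) : ℝ≥0∞) ≠ 0 := by
    rw [Nat.cast_ne_zero]; omega
  have h3 := ENNReal.toReal_mono (ENNReal.mul_ne_top ENNReal.ofReal_ne_top
    (ENNReal.div_ne_top ENNReal.one_ne_top (mul_ne_zero (by norm_num) (pow_ne_zero 2 hm1)))) h2
  rw [ENNReal.toReal_mul, ENNReal.toReal_ofReal hr.le, ENNReal.toReal_div, ENNReal.toReal_mul,
    ENNReal.toReal_pow, ENNReal.toReal_natCast, Nat.cast_sub (by omega)] at h3
  have hm' : (2 : ℝ) ≤ m := by exact_mod_cast hm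
  have hpos : (0 : ℝ) < 18 * ((m : ℝ) - 1) ^ 2 := by
    have : (0 : ℝ) < m - 1 := by linarith
    positivity
  rw [ENNReal.toReal_one, ENNReal.toReal_ofNat, Nat.cast_one, mul_one_div, le_div_iff₀ hpos] at h3
  linarith

end ScatteredConvexity

end

theorem mainTheorem6 (d m n : ℕ) (hm : (d : ℝ) / 2 < m)
    (X : Set (ScatteredConvexity.E d)) (r : ℝ) (hX : ScatteredConvexity.IsUnionOfBalls X r)
    (H : Type*) [NormedAddCommGroup H] [InnerProductSpace ℝ H] [CompleteSpace H] [RKHS ℝ H X ℝ]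
    (k : ScatteredConvexity.E d → ScatteredConvexity.E d → ℝ)
    (hk : ∀ x y : X, RKHS.kernel H x y (1 : ℝ) = k x y)
    (M : ℝ) (hM : 1 ≤ M) (hprod : ScatteredConvexity.ProductBounded H M)
    (D : ℝ) (hD : 1 ≤ D) (hder : ScatteredConvexity.KernelDerivBounded k X m D)
    (xs : Fin n → ScatteredConvexity.E d) (hxs : ∀ i, xs i ∈ X)
    (hfill : ScatteredConvexity.fillDistance xs X ≤
      ENNReal.ofReal r * min 1 (1 / (18 * ((m - 1 : ℕ) : ENNReal) ^ 2)))
    (R : Matrix (Fin n) (Fin n) ℝ) (hR : ScatteredConvexity.IsUpperFactor R k xs)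
    (f : ScatteredConvexity.E d → ℝ) (hf : ContDiffOn ℝ ((m + 2 : ℕ) : ℕ∞) f X)
    (B : Matrix (Fin n × Fin d) (Fin n × Fin d) ℝ) (hB : B.PosSemidef)
    (hfB : ∀ j, ScatteredConvexity.hessian f (xs j) =
      (ScatteredConvexity.Psi d R j).transpose * B * ScatteredConvexity.Psi d R j)
    (η : ℝ)
    (hη : ((ScatteredConvexity.constC X m f M D B *
      ScatteredConvexity.fillDistance xs X ^ m : ENNReal) : EReal) ≤ (η : EReal)) :
    ScatteredConvexity.IsConvexOn (fun x => f x + η / 2 * ‖x‖ ^ 2) X := by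
  open ScatteredConvexity in
  have hXo := hX.isOpen
  have hf' : ContDiffOn ℝ (m + 2 : ℕ) f X := hf
  have hf2 : ContDiffOn ℝ (2 : ℕ) f X := hf'.of_le (by norm_cast; omega)
  have hdm : d < 2 * m := by
    have : (d : ℝ) < 2 * m := by linarith
    exact_mod_cast this
  obtain ⟨hfin, hhr, hmr⟩ := fillDistance_bounds hX.1 hfill
  obtain ⟨hηfin, hηle⟩ := ne_top_and_toReal_le_of_coe_le hη
  set h := (fillDistance xs X).toReal with hh
  have hη0 : 0 ≤ η := ENNReal.toReal_nonneg.trans hηle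
  have hnear (x : E d) (hx : x ∈ X) := exists_norm_sub_le_fillDistance hfin hx
  refine isConvexOn_of_quadratic_nonneg hXo hf2 fun x hx w =>
    quadratic_nonneg_of_unit (fun v hv => ?_) w
  have hd1 : 1 ≤ d := by
    by_contra hd0
    obtain rfl : d = 0 := by omega
    simp at hv
  obtain ⟨b, hbC, hb0, hbxs, hbK⟩ := exists_model (H := H) hXo hk (by linarith) hprod (by linarith)
    hder hxs hR hB hv.le
  have hdef (i : Fin n) : defect f v b (xs i) = 0 := by
    rw [defect, hbxs i, ← hfB i, sub_eq_zero]
    simp only [dotProduct, Matrix.mulVec, Finset.mul_sum]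
    refine Finset.sum_congr rfl fun a _ => Finset.sum_congr rfl fun c _ => ?_
    rw [hessian_eqOn hXo hf2 (hxs i)]
    ring
  -- Since `b ≥ 0`, a lower bound on the defect is a lower bound on `vᵀ H_f v`.
  suffices hlow : -η ≤ defect f v b x by
    have := hb0 x hx
    rw [defect] at hlow
    linarith
  -- If `h = 0`, every point of `X` is a node. This case is separate because `∞ · 0 = 0` would allow
  -- `constC` to be infinite; for `h > 0`, a real `η` forces it to be finite.
  rcases ENNReal.toReal_nonneg.eq_or_lt with h0 | hpos
  · obtain ⟨i, hi⟩ := hnear x hx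
    rw [← h0, norm_le_zero_iff, sub_eq_zero] at hi
    rw [← hi, hdef i]
    linarith
  have hC0 : 0 < constC0 d m := by
    unfold constC0
    have : (0 : ℝ) < max 1 (18 * ((m : ℝ) - 1) ^ 2) := lt_max_of_lt_left one_pos
    have : (0 : ℝ) < d := by exact_mod_cast hd1
    positivity
  have hKb0 : 0 ≤ M * D * B.trace :=
    mul_nonneg (mul_nonneg (by linarith) (by linarith)) hB.trace_nonneg
  have hCfin : constC X m f M D B ≠ ⊤ := fun htop => hηfin (by
    rw [htop, ENNReal.top_mul]
    exact pow_ne_zero m (ENNReal.toReal_pos_iff.1 hpos).1.ne')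
  have hsumfin : ∑ i, seminormCm X m (fun x => hessian f x i i) ≠ ⊤ := fun htop => hCfin (by
    rw [constC, htop, top_add, ENNReal.mul_top]
    simpa using hC0)
  have hKfin (i : Fin d) : seminormCm X m (fun x => hessian f x i i) ≠ ⊤ :=
    (ENNReal.sum_ne_top.1 hsumfin) i (Finset.mem_univ i)
  have hCreal : (constC X m f M D B).toReal = constC0 d m *
      (∑ i, (seminormCm X m (fun x => hessian f x i i)).toReal + M * D * B.trace) := by
    rw [constC, ENNReal.toReal_mul, ENNReal.toReal_ofReal hC0.le,
      ENNReal.toReal_add hsumfin ENNReal.ofReal_ne_top, ENNReal.toReal_ofReal hKb0,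
      ENNReal.toReal_sum fun i _ => hKfin i]
  rw [ENNReal.toReal_mul, ENNReal.toReal_pow, hCreal] at hηle
  have hmain := abs_defect_le hX hf' (fun i => ENNReal.toReal_nonneg)
    (fun i l hl x hx => abs_dlist_le_seminormCm hXo (dpart_dpart_contDiffOn hXo hf' i i)
      (fun y hy => hessian_eqOn hXo hf2 hy i i) (hKfin i) hl hx)
    hdm hd1 hv.le hbC hKb0 hbK (Set.range_subset_iff.2 hxs) hpos
    (fun y hy => by simpa using hnear y hy) hhr hmr (by simpa using hdef) hx
  have := (abs_le.1 hmain).1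
  linarith
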